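/- Let $K$ be a totally real number field and let $\mathcal O^+$ be the set of its totally positive algebraic integers. Every element of $\mathcal O^+\cup\{0\}$ is a sum of two elements of $\mathcal O^+\cup\{0\}$ in only finitely many ways, so the set $R=\mathbb R[[q]]_{\mathcal O^+\cup\{0\}}$ of all formal sums $\sum_{\delta\in\mathcal O^+\cup\{0\}}c_\delta q^\delta$ with $c_\delta\in\mathbb R$ is a commutative ring under $$\Big(\sum_\delta c_\delta q^\delta\Big)\Big(\sum_\delta d_\delta q^\delta\Big)=\sum_\gamma\Big(\sum_{\alpha+\beta=\gamma}c_\alpha d_\beta\Big)q^\gamma .$$ For $\delta\in\mathcal O^+$ the element $1-q^\delta$ is invertible in $R$, with inverse $\frac1{1-q^\delta}=1+q^\delta+q^{2\delta}+\cdots$. For $\gamma\in\mathcal O^+$ and $n\ge 0$ put $(q^\gamma)_n=\prod_{j=1}^{n}(1-q^{j\gamma})$. Let $f_m=\sum_\delta a_{m,\delta}q^\delta$ $(m\in I)$ be a family in $R$. The sum $\sum_{m\in I}f_m=\sum_\delta\big(\sum_{m\in I}a_{m,\delta}\big)q^\delta$ is defined if $\sum_{m\in I}a_{m,\delta}$ converges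 absolutely for every $\delta$. The product $\prod_{m\in I}f_m$ is defined if $a_{m,0}\neq1$ for only finitely many $m$ and, for each $\delta\ne0$, $a_{m,\delta}\ne0$ for only finitely many $m$; its coefficient of $q^\delta$ is then $\sum\prod_{m\in I}a_{m,\delta_m}$, the sum being over all families $(\delta_m)_{m\in I}$ in $\mathcal O^+\cup\{0\}$ with only finitely many nonzero members and with $\sum_m\delta_m=\delta$. Call $\gamma\in\mathcal O^+$ primitive if $\gamma\notin n\mathcal O^+$ for all integers $n\ge2$, and let $\mathcal P$ be the set of primitive elements. Every $\delta\in\mathcal O^+$ is uniquely of the form $\delta=s(\delta)\,\gamma$ with a positive integer $s(\delta)$, called the scale of $\delta$, and $\gamma\in\mathcal P$. Theorem. Let $k\ge2$ and $1\le i\le k$ be integers. Then all the infinite sums and products below are defined, and in $R$ $$\prod_{\gamma\in\mathcal P}\left(\sum_{n_1,\ldots,n_{k-1}\ge0}\frac{q^{(N_1^2+\cdots+N_{k-1}^2+N_i+N_{i+1}+\cdots+N_{k-1})\gamma}}{(q^\gamma)_{n_1}(q^\gamma)_{n_2}\cdots(q^\gamma)_{n_{k-1}}}\right)=\prod_{\gamma\in\mathcal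 P}\left(\prod_{\substack{n\ge1\\ n\not\equiv0,\pm i\ (\mathrm{mod}\ 2k+1)}}\frac1{1-q^{n\gamma}}\right)=\prod_{\substack{\delta\in\mathcal O^+\\ s(\delta)\not\equiv0,\pm i\ (\mathrm{mod}\ 2k+1)}}\frac1{1-q^\delta},$$ where $N_j=n_j+n_{j+1}+\cdots+n_{k-1}$. -/

import Mathlib

open NumberField

noncomputable section

/-! ### Formal q-sums with exponents in an additive monoid -/

/-- The formal `q`-sums `∑_{δ ∈ H} c_δ q^δ` with arbitrary real coefficients, a formal `q`-sum
being the same as its family of coefficients. -/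
def FormalQSum (H : Type*) : Type _ := H → ℝ

namespace FormalQSum

/-- The coefficient of `q^δ`. -/
def coeff {H : Type*} (f : FormalQSum H) (δ : H) : ℝ := f δ

@[ext]
theorem ext {H : Type*} {f g : FormalQSum H} (h : ∀ δ, f.coeff δ = g.coeff δ) : f = g :=
  funext h

instance {H : Type*} : AddCommGroup (FormalQSum H) := inferInstanceAs (AddCommGroup (H → ℝ))

theorem coeff_zero {H : Type*} (δ : H) : (0 : FormalQSum H).coeff δ = 0 := rfl

theorem coeff_add {H : Type*} (f g : FormalQSum H) (δ : H) :
    (f + g).coeff δ = f.coeff δ + g.coeff δ := rfl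

theorem coeff_sub {H : Type*} (f g : FormalQSum H) (δ : H) :
    (f - g).coeff δ = f.coeff δ - g.coeff δ := rfl

open Classical in
/-- The monomial `q^δ`. -/
def qpow {H : Type*} (δ : H) : FormalQSum H := fun β => if β = δ then 1 else 0

open Classical in
theorem coeff_qpow {H : Type*} (δ β : H) :
    (qpow δ).coeff β = if β = δ then 1 else 0 := rfl

section Ring

variable {H : Type*} [AddCommMonoid H] [Finset.HasAntidiagonal H]

instance : One (FormalQSum H) := ⟨qpow 0⟩

/-- The product: the coefficient of `q^γ` in `f g` is `∑_{α + β = γ} c_α d_β`. -/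
instance : Mul (FormalQSum H) :=
  ⟨fun f g γ => ∑ p ∈ Finset.HasAntidiagonal.antidiagonal γ, f p.1 * g p.2⟩

theorem one_eq_qpow : (1 : FormalQSum H) = qpow 0 := rfl

theorem coeff_mul (f g : FormalQSum H) (γ : H) :
    (f * g).coeff γ = ∑ p ∈ Finset.HasAntidiagonal.antidiagonal γ, f.coeff p.1 * g.coeff p.2 := rfl

theorem mul_comm' (f g : FormalQSum H) : f * g = g * f := by
  ext γ
  rw [coeff_mul, coeff_mul]
  refine Finset.sum_nbij' Prod.swap Prod.swap ?_ ?_ ?_ ?_ ?_ <;>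
    simp [add_comm, mul_comm]

theorem one_mul' (f : FormalQSum H) : 1 * f = f := by
  classical
  ext γ
  rw [coeff_mul, one_eq_qpow, Finset.sum_eq_single ((0 : H), γ)]
  · simp [coeff_qpow]
  · rintro ⟨a, b⟩ hab hne
    rw [coeff_qpow, if_neg, zero_mul]
    rintro rfl
    simp only [Finset.HasAntidiagonal.mem_antidiagonal, zero_add] at hab
    exact hne (by rw [hab])
  · intro h
    simp at h

theorem mul_assoc' (f g h : FormalQSum H) : f * g * h = f * (g * h) := by
  ext n
  simp only [coeff_mul, Finset.sum_mul, Finset.mul_sum, Finset.sum_sigma']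
  refine Finset.sum_nbij' (fun x => ⟨(x.2.1, x.2.2 + x.1.2), (x.2.2, x.1.2)⟩)
    (fun x => ⟨(x.1.1 + x.2.1, x.2.2), (x.1.1, x.2.1)⟩) ?_ ?_ ?_ ?_ ?_
  · rintro ⟨⟨a, b⟩, ⟨c, d⟩⟩ hx
    simp only [Finset.mem_sigma, Finset.HasAntidiagonal.mem_antidiagonal] at hx ⊢
    exact ⟨by rw [← hx.1, ← hx.2, add_assoc], trivial⟩
  · rintro ⟨⟨a, b⟩, ⟨c, d⟩⟩ hx
    simp only [Finset.mem_sigma, Finset.HasAntidiagonal.mem_antidiagonal] at hx ⊢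
    exact ⟨by rw [← hx.1, ← hx.2, add_assoc], trivial⟩
  · rintro ⟨⟨a, b⟩, ⟨c, d⟩⟩ hx
    simp only [Finset.mem_sigma, Finset.HasAntidiagonal.mem_antidiagonal] at hx
    obtain ⟨rfl, rfl⟩ := hx
    rfl
  · rintro ⟨⟨a, b⟩, ⟨c, d⟩⟩ hx
    simp only [Finset.mem_sigma, Finset.HasAntidiagonal.mem_antidiagonal] at hx
    obtain ⟨rfl, rfl⟩ := hx
    rfl
  · rintro ⟨⟨a, b⟩, ⟨c, d⟩⟩ hx
    simp only [mul_assoc]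

theorem mul_add' (f g h : FormalQSum H) : f * (g + h) = f * g + f * h := by
  ext n
  simp only [coeff_mul, coeff_add, mul_add, Finset.sum_add_distrib]

theorem zero_mul' (f : FormalQSum H) : 0 * f = 0 := by
  ext n
  simp only [coeff_mul, coeff_zero, zero_mul, Finset.sum_const_zero]

/-- The ring of formal `q`-sums. -/
instance : CommRing (FormalQSum H) where
  mul_comm := mul_comm'
  one_mul := one_mul'
  mul_one f := by rw [mul_comm', one_mul']
  mul_assoc := mul_assoc'
  left_distrib := mul_add'
  right_distrib f g h := by rw [mul_comm', mul_add', mul_comm' f, mul_comm' g]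
  zero_mul := zero_mul'
  mul_zero f := by rw [mul_comm', zero_mul']
  zsmul n f := n • f
  zsmul_zero' := zero_zsmul
  zsmul_succ' n f := SubNegMonoid.zsmul_succ' n f
  zsmul_neg' n f := SubNegMonoid.zsmul_neg' n f
  neg_add_cancel := neg_add_cancel

/-- `(q^δ; q^δ)_n = (1 - q^δ)(1 - q^{2δ}) ⋯ (1 - q^{nδ})`. -/
def qPoch (δ : H) (n : ℕ) : FormalQSum H :=
  ∏ j ∈ Finset.Icc 1 n, (1 - qpow (j • δ))

end Ring

section Infinite

variable {H : Type*} {I : Type*}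

/-- The condition under which the sum of a family of formal `q`-sums is defined: for each
exponent, the series of the coefficients converges absolutely. -/
def IsSummable (f : I → FormalQSum H) : Prop :=
  ∀ δ : H, Summable fun i => |(f i).coeff δ|

/-- The sum of a family of formal `q`-sums, coefficient by coefficient. -/
def qsum (f : I → FormalQSum H) : FormalQSum H :=
  fun δ => ∑' i, (f i).coeff δ

variable [AddCommMonoid H]

/-- The condition under which the product of a family of formal `q`-sums is defined: all but
finitely many constant terms are `1`, and each `q^δ` with `δ ≠ 0` occurs in only finitely many
members of the family. -/
def IsMultipliable (f : I → FormalQSum H) : Prop :=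
  {i | (f i).coeff 0 ≠ 1}.Finite ∧ ∀ δ : H, δ ≠ 0 → {i | (f i).coeff δ ≠ 0}.Finite

/-- The product of a family of formal `q`-sums `f_i = ∑_δ a_{i,δ} q^δ`. The coefficient of `q^δ`
is the sum of the products `∏_i a_{i,δ_i}` over all choices of one exponent `δ_i` for each index,
almost all of them zero, that add up to `δ`. -/
def qprod (f : I → FormalQSum H) : FormalQSum H :=
  fun δ => ∑ᶠ (v : I →₀ H) (_ : (v.sum fun _ x => x) = δ), ∏ᶠ i, (f i).coeff (v i)

end Infinite

end FormalQSum

/-! ### Totally positive integers of a number field -/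

/-- An integer of `K` is totally positive if all its real conjugates are positive (this is used
for totally real `K`, all of whose embeddings are real). -/
def IsTotallyPositive {K : Type*} [Field K] (x : 𝓞 K) : Prop :=
  ∀ φ : K →+* ℝ, 0 < φ (x : K)

/-- `O⁺ ∪ {0}`: the additive monoid of the integers that are zero or totally positive. -/
def OPlusZero (K : Type*) [Field K] : AddSubmonoid (𝓞 K) where
  carrier := {x | x = 0 ∨ IsTotallyPositive x}
  zero_mem' := Or.inl rfl
  add_mem' := by
    rintro a b (rfl | ha) (rfl | hb)
    · exact Or.inl (add_zero 0)
    · exact Or.inr (by rwa [zero_add])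
    · exact Or.inr (by rwa [add_zero])
    · refine Or.inr fun φ => ?_
      have h1 := ha φ
      have h2 := hb φ
      rw [RingOfIntegers.coe_eq_algebraMap] at h1 h2 ⊢
      rw [map_add, map_add]
      exact add_pos h1 h2

/-- `O⁺`: the totally positive integers, as members of `O⁺ ∪ {0}`. -/
abbrev OPlus (K : Type*) [Field K] : Type _ :=
  {δ : OPlusZero K // IsTotallyPositive (δ : 𝓞 K)}

/-- The primitive set of `K` over `ℚ`: the totally positive integers that are not of the form
`n β` with `β` totally positive and `n` a non-unit among the positive rational integers. -/
def primitiveSet (K : Type*) [Field K] : Set (OPlus K) :=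
  {γ | ∀ n : ℕ, 2 ≤ n → ∀ β : OPlus K, γ.1 ≠ n • β.1}

section TotallyReal

variable {K : Type*} [Field K] [NumberField K] [IsTotallyReal K]

theorem exists_real_embedding (φ : K →+* ℂ) :
    ∃ ψ : K →+* ℝ, ∀ x, φ x = ((ψ x : ℝ) : ℂ) :=
  ⟨(IsTotallyReal.complexEmbedding_isReal φ).embedding, fun x =>
    ((IsTotallyReal.complexEmbedding_isReal φ).coe_embedding_apply x).symm⟩

variable (K) in
theorem nonempty_real_embedding : Nonempty (K →+* ℝ) := by
  obtain ⟨φ⟩ : Nonempty (K →+* ℂ) := inferInstance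
  exact ⟨(exists_real_embedding φ).choose⟩

theorem IsTotallyPositive.ne_zero {x : 𝓞 K} (hx : IsTotallyPositive x) : x ≠ 0 := by
  rintro rfl
  obtain ⟨φ⟩ := nonempty_real_embedding K
  have := hx φ
  simp at this

theorem OPlusZero.nonneg (x : OPlusZero K) (φ : K →+* ℝ) :
    0 ≤ φ ((x : 𝓞 K) : K) := by
  rcases x.2 with h | h
  · rw [h]; simp
  · exact (h φ).le

theorem OPlusZero.isTotallyPositive {x : OPlusZero K} (hx : x ≠ 0) :
    IsTotallyPositive (x : 𝓞 K) :=
  x.2.resolve_left fun h => hx (Subtype.ext h)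

theorem OPlus.ne_zero (x : OPlus K) : x.1 ≠ 0 :=
  fun h => x.2.ne_zero (congrArg Subtype.val h)

/-- An element of `O⁺ ∪ {0}` has only finitely many summands. -/
theorem OPlusZero.finite_summands (δ : OPlusZero K) :
    {α : OPlusZero K | ∃ β : OPlusZero K, α + β = δ}.Finite := by
  classical
  obtain ⟨B, hB⟩ : ∃ B : ℝ, ∀ φ : K →+* ℂ, ‖φ ((δ : 𝓞 K) : K)‖ ≤ B :=
    ⟨∑ φ : K →+* ℂ, ‖φ ((δ : 𝓞 K) : K)‖, fun φ =>
      Finset.single_le_sum (f := fun φ : K →+* ℂ => ‖φ ((δ : 𝓞 K) : K)‖)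
        (fun _ _ => norm_nonneg _) (Finset.mem_univ φ)⟩
  have hfin := Embeddings.finite_of_norm_le K ℂ B
  refine Set.Finite.of_finite_image (f := fun α : OPlusZero K => ((α : 𝓞 K) : K))
    (hfin.subset ?_) ?_
  · rintro _ ⟨α, ⟨β, rfl⟩, rfl⟩
    refine ⟨(α : 𝓞 K).isIntegral_coe, fun φ => (le_trans ?_ (hB φ))⟩
    obtain ⟨ψ, hψ⟩ := exists_real_embedding φ
    have h1 := OPlusZero.nonneg α ψ
    have h2 := OPlusZero.nonneg β ψ
    rw [hψ, hψ, Complex.norm_real, Complex.norm_real, Real.norm_of_nonneg h1,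
      Real.norm_of_nonneg (OPlusZero.nonneg (α + β) ψ)]
    have : (((α + β : OPlusZero K) : 𝓞 K) : K) = ((α : 𝓞 K) : K) + ((β : 𝓞 K) : K) := by
      simp
    rw [this, map_add]
    linarith
  · intro a _ b _ hab
    exact Subtype.ext (RingOfIntegers.ext hab)

/-- Every element of `O⁺ ∪ {0}` is a sum of two such elements in only finitely many ways, so that
the product of formal `q`-sums makes sense. -/
instance : Finset.HasAntidiagonal (OPlusZero K) where
  antidiagonal δ :=
    Set.Finite.toFinset (s := {p : OPlusZero K × OPlusZero K | p.1 + p.2 = δ})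
      (((OPlusZero.finite_summands δ).prod (OPlusZero.finite_summands δ)).subset
        fun p hp => ⟨⟨p.2, hp⟩, ⟨p.1, by rw [add_comm]; exact hp⟩⟩)
  mem_antidiagonal := by simp

theorem OPlusZero.nsmul_right_cancel {δ : OPlusZero K} (hδ : δ ≠ 0) {m n : ℕ}
    (h : m • δ = n • δ) : m = n := by
  have h' := congrArg (Subtype.val) h
  simp only [AddSubmonoidClass.coe_nsmul, nsmul_eq_mul] at h'
  have h0 : (δ : 𝓞 K) ≠ 0 := fun h => hδ (Subtype.ext h)
  exact_mod_cast mul_right_cancel₀ h0 h'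

theorem OPlus.nsmul_pos {n : ℕ} {β δ : OPlus K} (h : δ.1 = n • β.1) : 0 < n := by
  rcases Nat.eq_zero_or_pos n with rfl | hn
  · exact absurd (by rw [h, zero_nsmul]) δ.ne_zero
  · exact hn

theorem OPlus.exists_radial (δ : OPlus K) :
    ∃ p : ℕ × OPlus K, p.2 ∈ primitiveSet K ∧ δ.1 = p.1 • p.2.1 := by
  classical
  have hfin : {n : ℕ | ∃ β : OPlus K, δ.1 = n • β.1}.Finite := by
    haveI : Nonempty (OPlus K) := ⟨δ⟩
    choose! f hf using fun (n : ℕ) (h : ∃ β : OPlus K, δ.1 = n • β.1) => h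
    refine Set.Finite.of_finite_image (f := fun n => (f n).1)
      ((OPlusZero.finite_summands δ.1).subset ?_) ?_
    · rintro _ ⟨n, hn, rfl⟩
      obtain ⟨m, rfl⟩ : ∃ m, n = m + 1 := ⟨n - 1, by have := OPlus.nsmul_pos (hf n hn); omega⟩
      exact ⟨m • (f (m + 1)).1, by rw [hf _ hn, succ_nsmul, add_comm]⟩
    · intro m hm n hn hmn
      refine OPlusZero.nsmul_right_cancel (f m).ne_zero ?_
      rw [← hf m hm, hf n hn]
      exact congrArg (n • ·) hmn.symm
  obtain ⟨n, ⟨γ, hγ⟩, hmax⟩ := Set.exists_max_image _ id hfin ⟨1, δ, (one_nsmul _).symm⟩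
  refine ⟨(n, γ), fun m hm β hβ => ?_, hγ⟩
  have h1 : n * m ≤ n := hmax (n * m) ⟨β, by rw [hγ, hβ, mul_nsmul']⟩
  have h2 := OPlus.nsmul_pos hγ
  nlinarith

theorem OPlus.radial_aux {γ γ' : OPlus K} (hγ : γ ∈ primitiveSet K)
    {a b : ℕ} (hb : 0 < b) (hab : Nat.Coprime a b) (h : a • γ.1 = b • γ'.1) : b = 1 := by
  have hbez : (a : ℤ) * Nat.gcdA a b + b * Nat.gcdB a b = 1 := by
    rw [← Nat.gcd_eq_gcd_ab, hab.gcd_eq_one, Nat.cast_one]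
  have h' : (a : 𝓞 K) * γ.1 = b * γ'.1 := by
    simpa only [AddSubmonoidClass.coe_nsmul, nsmul_eq_mul] using congrArg Subtype.val h
  have hbez' : (a : 𝓞 K) * (Nat.gcdA a b : 𝓞 K) + b * (Nat.gcdB a b : 𝓞 K) = 1 := by
    exact_mod_cast congrArg (Int.cast : ℤ → 𝓞 K) hbez
  obtain ⟨β, hβ⟩ : ∃ β : 𝓞 K, (γ.1 : 𝓞 K) = b * β :=
    ⟨(Nat.gcdA a b : 𝓞 K) * γ'.1 + (Nat.gcdB a b : 𝓞 K) * γ.1, by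
      linear_combination (-(γ.1 : 𝓞 K)) * hbez' + (Nat.gcdA a b : 𝓞 K) * h'⟩
  have hpos : IsTotallyPositive β := fun φ => by
    have h1 := γ.2 φ
    rw [hβ] at h1
    have h2 : φ ((b * β : 𝓞 K) : K) = b * φ (β : K) := by simp
    rw [h2] at h1
    exact pos_of_mul_pos_right h1 (Nat.cast_nonneg b)
  by_contra hne
  refine hγ b (by omega) ⟨⟨β, Or.inr hpos⟩, hpos⟩ (Subtype.ext ?_)
  rw [AddSubmonoidClass.coe_nsmul, nsmul_eq_mul]
  exact hβ

/-- The radial decomposition: every totally positive integer is `n γ` for a unique positive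
integer `n` and a unique primitive `γ`. -/
theorem OPlus.existsUnique_radial (δ : OPlus K) :
    ∃! p : ℕ × OPlus K, p.2 ∈ primitiveSet K ∧ δ.1 = p.1 • p.2.1 := by
  refine existsUnique_of_exists_of_unique δ.exists_radial ?_
  rintro ⟨n, γ⟩ ⟨n', γ'⟩ ⟨hγ, h⟩ ⟨hγ', h'⟩
  simp only at hγ h hγ' h'
  have hn := OPlus.nsmul_pos h
  have hn' := OPlus.nsmul_pos h'
  obtain ⟨g, a, b, hg, hab, rfl, rfl⟩ := Nat.exists_coprime' (Nat.gcd_pos_of_pos_left n' hn)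
  have ha : 0 < a := Nat.pos_of_mul_pos_right hn
  have hb : 0 < b := Nat.pos_of_mul_pos_right hn'
  have hk : a • γ.1 = b • γ'.1 := by
    have h2 := congrArg Subtype.val (h.symm.trans h')
    simp only [AddSubmonoidClass.coe_nsmul, nsmul_eq_mul, Nat.cast_mul] at h2
    refine Subtype.ext ?_
    simp only [AddSubmonoidClass.coe_nsmul, nsmul_eq_mul]
    have hg0 : ((g : ℕ) : 𝓞 K) ≠ 0 := by exact_mod_cast hg.ne'
    exact mul_left_cancel₀ hg0 (by linear_combination h2)
  have hb1 := OPlus.radial_aux hγ hb hab hk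
  have ha1 := OPlus.radial_aux hγ' ha hab.symm hk.symm
  subst hb1 ha1
  rw [one_nsmul, one_nsmul] at hk
  rw [Subtype.ext hk]

/-- The scale `s(δ)`: the positive integer `n` in the radial decomposition `δ = n γ`. -/
def scale (δ : OPlus K) : ℕ := δ.existsUnique_radial.choose.1

/-- The primitive factor `t(δ)`: the element `γ` in the radial decomposition `δ = n γ`. -/
def primitiveFactor (δ : OPlus K) : OPlus K := δ.existsUnique_radial.choose.2

theorem primitiveFactor_mem (δ : OPlus K) : primitiveFactor δ ∈ primitiveSet K :=
  δ.existsUnique_radial.choose_spec.1.1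

theorem scale_nsmul_primitiveFactor (δ : OPlus K) : δ.1 = scale δ • (primitiveFactor δ).1 :=
  δ.existsUnique_radial.choose_spec.1.2

/-! ### The quotients `1 / (1 - q^δ)` and `1 / (q^δ; q^δ)_n` -/

namespace FormalQSum

theorem one_sub_qpow_mul_geom {δ : OPlusZero K} (hδ : δ ≠ 0) :
    (1 - qpow δ) * qsum (fun m : ℕ => qpow (m • δ)) = 1 := by
  classical
  have hc : ∀ β, (qsum (fun m : ℕ => qpow (m • δ))).coeff β =
      if ∃ m : ℕ, β = m • δ then 1 else 0 := by
    intro β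
    change ∑' m : ℕ, (qpow (m • δ)).coeff β = _
    simp only [coeff_qpow]
    split_ifs with h
    · obtain ⟨m, rfl⟩ := h
      rw [tsum_eq_single m]
      · simp
      · intro n hn
        rw [if_neg]
        intro h
        exact hn (OPlusZero.nsmul_right_cancel hδ h).symm
    · push Not at h
      simp [h]
  rw [sub_mul, one_mul]
  ext γ
  rw [coeff_sub, coeff_mul, hc, one_eq_qpow, coeff_qpow]
  by_cases hγ : ∃ β, δ + β = γ
  · obtain ⟨β, rfl⟩ := hγ
    rw [Finset.sum_eq_single (δ, β), coeff_qpow, if_pos rfl, one_mul, hc]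
    · have h0 : δ + β ≠ 0 := by
        intro h
        obtain ⟨φ⟩ := nonempty_real_embedding K
        have h1 := OPlusZero.isTotallyPositive hδ φ
        have h2 := OPlusZero.nonneg β φ
        have h3 : ((δ : 𝓞 K) : K) + ((β : 𝓞 K) : K) = 0 := by
          have := congrArg (fun x : OPlusZero K => ((x : 𝓞 K) : K)) h
          simpa using this
        have h4 := congrArg φ h3
        rw [map_add, map_zero] at h4
        linarith
      have hiff : (∃ m : ℕ, δ + β = m • δ) ↔ ∃ m : ℕ, β = m • δ := by
        constructor
        · rintro ⟨m, hm⟩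
          obtain ⟨m, rfl⟩ : ∃ l, m = l + 1 := by
            rcases m with _ | l
            · exact absurd (by rw [hm, zero_nsmul]) h0
            · exact ⟨l, rfl⟩
          exact ⟨m, by rw [succ_nsmul, add_comm] at hm; exact add_right_cancel hm⟩
        · rintro ⟨m, rfl⟩
          exact ⟨m + 1, by rw [succ_nsmul, add_comm]⟩
      simp [hiff, h0]
    · rintro ⟨a, b⟩ hab hne
      rw [coeff_qpow, if_neg, zero_mul]
      rintro rfl
      exact hne (Prod.ext rfl
        (add_left_cancel (Finset.HasAntidiagonal.mem_antidiagonal.1 hab)))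
    · intro h
      simp at h
  · rw [Finset.sum_eq_zero, sub_zero]
    · have hiff : (∃ m : ℕ, γ = m • δ) ↔ γ = 0 := by
        constructor
        · rintro ⟨m, rfl⟩
          rcases m with _ | l
          · rw [zero_nsmul]
          · exact absurd ⟨l • δ, by rw [succ_nsmul, add_comm]⟩ hγ
        · rintro rfl
          exact ⟨0, (zero_nsmul _).symm⟩
      by_cases h0 : γ = 0
      · rw [if_pos (hiff.2 h0), if_pos h0]
      · rw [if_neg (fun h => h0 (hiff.1 h)), if_neg h0]
    · rintro ⟨a, b⟩ hab
      rw [coeff_qpow, if_neg, zero_mul]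
      rintro rfl
      exact hγ ⟨b, Finset.HasAntidiagonal.mem_antidiagonal.1 hab⟩

theorem isUnit_one_sub_qpow {δ : OPlusZero K} (hδ : δ ≠ 0) :
    IsUnit (1 - qpow δ : FormalQSum (OPlusZero K)) :=
  IsUnit.of_mul_eq_one _ (one_sub_qpow_mul_geom hδ)

/-- `1 / (1 - q^δ) = 1 + q^δ + q^{2δ} + ⋯`. -/
theorem inverse_one_sub_qpow {δ : OPlusZero K} (hδ : δ ≠ 0) :
    Ring.inverse (1 - qpow δ) = qsum (fun m : ℕ => qpow (m • δ)) := by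
  have h := Ring.inverse_mul_cancel _ (isUnit_one_sub_qpow hδ)
  calc Ring.inverse (1 - qpow δ)
      = Ring.inverse (1 - qpow δ) * ((1 - qpow δ) * qsum (fun m : ℕ => qpow (m • δ))) := by
        rw [one_sub_qpow_mul_geom hδ, mul_one]
    _ = qsum (fun m : ℕ => qpow (m • δ)) := by rw [← mul_assoc, h, one_mul]

theorem isUnit_qPoch {δ : OPlusZero K} (hδ : δ ≠ 0) (n : ℕ) : IsUnit (qPoch δ n) := by
  refine (IsUnit.prod_iff).2 fun j hj => isUnit_one_sub_qpow fun h => ?_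
  have := OPlusZero.nsmul_right_cancel hδ (h.trans (zero_nsmul δ).symm)
  simp only [Finset.mem_Icc] at hj
  omega

end FormalQSum

end TotallyReal

/-! ### The two sides of the generalized Gordon identity -/

/-- `N_j = n_j + n_{j+1} + ⋯ + n_{k-1}`; the index `j : Fin (k - 1)` stands for `j + 1`. -/
def gordonN {k : ℕ} (n : Fin (k - 1) → ℕ) (j : Fin (k - 1)) : ℕ :=
  ∑ l ∈ Finset.Ici j, n l

/-- The exponent `N_1² + ⋯ + N_{k-1}² + N_i + N_{i+1} + ⋯ + N_{k-1}`. -/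
def gordonExponent {k : ℕ} (i : ℕ) (n : Fin (k - 1) → ℕ) : ℕ :=
  (∑ j, gordonN n j ^ 2) + ∑ j ∈ Finset.univ.filter (fun j : Fin (k - 1) => i ≤ (j : ℕ) + 1), gordonN n j

/-- The general term `q^{(N_1² + ⋯ + N_{k-1}² + N_i + ⋯ + N_{k-1}) γ} /
((q^γ)_{n_1} ⋯ (q^γ)_{n_{k-1}})` of the multisum. -/
def gordonTerm {K : Type*} [Field K] [NumberField K] [IsTotallyReal K] {k : ℕ} (i : ℕ)
    (γ : OPlus K) (n : Fin (k - 1) → ℕ) : FormalQSum (OPlusZero K) :=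
  FormalQSum.qpow (gordonExponent i n • γ.1) *
    Ring.inverse (∏ j, FormalQSum.qPoch γ.1 (n j))

/-- The multisum over all `n_1, …, n_{k-1} ≥ 0`. -/
def gordonSum {K : Type*} [Field K] [NumberField K] [IsTotallyReal K] (k i : ℕ)
    (γ : OPlus K) : FormalQSum (OPlusZero K) :=
  FormalQSum.qsum (fun n : Fin (k - 1) → ℕ => gordonTerm i γ n)

/-- `n ≢ 0, i, -i` modulo `2 k + 1`. -/
def GordonAdmissible (k i n : ℕ) : Prop :=
  ¬ (n : ℤ) ≡ 0 [ZMOD 2 * k + 1] ∧ ¬ (n : ℤ) ≡ i [ZMOD 2 * k + 1] ∧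
    ¬ (n : ℤ) ≡ -i [ZMOD 2 * k + 1]

end

open PowerSeries Finset
open scoped PowerSeries.WithPiTopology

/-! ### Infinite sums of power series -/

/-! The theorem is the Andrews–Gordon identity in the single variable q^γ, multiplied over all
primitive γ. Substituting q^γ for X is a ring homomorphism `radial γ` from ℝ⟦X⟧ to R, so for each γ
the inner sum and the inner product reduce to one-variable power series. The radial decomposition δ
= s(δ)γ matches pairs (γ, n), n admissible, with those δ whose scale is admissible; this merges the
double product into one.

Infinite products in R are handled in the quotients by `summandIdeal δ`. As δ has finitely many
summands, all but finitely many factors become 1 there and `mk_qprod` turns `qprod` into a finite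
product. Since δ is a summand of itself, these quotients together detect equality.

The one-variable identity follows Andrews. Put k = l + 1. The multisum gets an extra parameter x =
q^m (`andrewsSeries`) and is compared with an alternating series (`selbergSeries`). Both (q)_∞ times
the first and the second satisfy D_{i+1}(m) - D_i(m) = X^{(m+1)i} D_{k-i}(m+1), vanish at i = 0, and
for i = k agree modulo X^{m+1}; `eq_zero_of_gordon_recurrence` then forces equality. At m = 0 the
alternating series is a theta series, which the Jacobi triple product evaluates as the product of 1
- X^n over n ≡ 0, ±i modulo 2k+1. Cancelling these factors from (q)_∞ leaves the reciprocal of the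
product side. The triple product is used in a finite form coming from the Gauss binomial theorem, so
that on the product side only congruences modulo powers of X occur. -/

theorem PowerSeries.summable_of_X_pow_dvd {f : ℕ → ℝ⟦X⟧} (h : ∀ n, X ^ n ∣ f n) : Summable f := by
  rw [WithPiTopology.summable_iff_summable_coeff]
  intro d
  refine summable_of_hasFiniteSupport ((Set.finite_Iic d).subset fun n hn => ?_)
  by_contra hlt
  exact hn (X_pow_dvd_iff.1 (h n) d (not_le.1 hlt))

theorem PowerSeries.X_pow_dvd_tsum {ι : Type*} {f : ι → ℝ⟦X⟧} {d : ℕ} (hf : Summable f)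
    (h : ∀ n, X ^ d ∣ f n) : X ^ d ∣ ∑' n, f n := by
  rw [X_pow_dvd_iff]
  intro m hm
  have := (WithPiTopology.hasSum_iff_hasSum_coeff _).1 hf.hasSum m
  rw [← this.tsum_eq]
  simp [fun n => X_pow_dvd_iff.1 (h n) m hm]

/-! ### Finite and infinite `q`-Pochhammer symbols -/

/-- The Pochhammer symbol `(y; y)_n = (1 - y) (1 - y²) ⋯ (1 - yⁿ)`. -/
def qPochhammer {R : Type*} [CommRing R] (y : R) (n : ℕ) : R := ∏ j ∈ range n, (1 - y ^ (j + 1))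

theorem qPochhammer_zero {R : Type*} [CommRing R] (y : R) : qPochhammer y 0 = 1 := prod_range_zero _

theorem qPochhammer_succ {R : Type*} [CommRing R] (y : R) (n : ℕ) :
    qPochhammer y (n + 1) = qPochhammer y n * (1 - y ^ (n + 1)) := prod_range_succ _ _

/-- The additional factors 1 - y^j have j > m, so each is 1 modulo y^{m+1}. -/
theorem dvd_qPochhammer_sub_qPochhammer {R : Type*} [CommRing R] (y : R) {m n : ℕ} (h : m ≤ n) :
    y ^ (m + 1) ∣ qPochhammer y n - qPochhammer y m := by
  induction n, h using Nat.le_induction with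
  | base => simp
  | succ n hmn ih =>
    have : qPochhammer y (n + 1) - qPochhammer y m =
      qPochhammer y n - qPochhammer y m - y ^ (n + 1) * qPochhammer y n := by
      rw [qPochhammer_succ]; ring
    rw [this]
    exact dvd_sub ih (Dvd.dvd.mul_right (pow_dvd_pow _ (by omega)) _)

theorem constantCoeff_qPochhammer {y : ℝ⟦X⟧} (hy : constantCoeff y = 0) (n : ℕ) :
    constantCoeff (qPochhammer y n) = 1 := by
  rw [qPochhammer, map_prod]
  exact prod_eq_one fun j _ => by simp [hy]

theorem qPochhammer_mul_inv (n : ℕ) :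
    qPochhammer (X : ℝ⟦X⟧) n * (qPochhammer X n)⁻¹ = 1 :=
  PowerSeries.mul_inv_cancel _ (by simp [constantCoeff_qPochhammer])

theorem one_sub_X_pow_mul_inv_qPochhammer_succ (n : ℕ) :
    (qPochhammer (X : ℝ⟦X⟧) (n + 1))⁻¹ * (1 - X ^ (n + 1)) = (qPochhammer X n)⁻¹ := by
  have h1 := qPochhammer_mul_inv n
  have h2 := qPochhammer_mul_inv (n + 1)
  rw [qPochhammer_succ] at h2 ⊢
  linear_combination (qPochhammer (X : ℝ⟦X⟧) n)⁻¹ * h2 -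
    (qPochhammer X n * (1 - X ^ (n + 1)))⁻¹ * (1 - X ^ (n + 1)) * h1

/-- The Euler function `(q; q)_∞` as a power series. -/
noncomputable def eulerSeries : ℝ⟦X⟧ := mk fun d => coeff d (qPochhammer (X : ℝ⟦X⟧) d)

/-- The coefficient of X^d in (q)_n no longer changes once n ≥ d, so the diagonal definition of
`eulerSeries` agrees with (q)_n up to degree n. -/
theorem X_pow_dvd_eulerSeries_sub (n : ℕ) :
    (X : ℝ⟦X⟧) ^ (n + 1) ∣ eulerSeries - qPochhammer X n := by
  rw [X_pow_dvd_iff]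
  intro d hd
  have := X_pow_dvd_iff.1 (dvd_qPochhammer_sub_qPochhammer (X : ℝ⟦X⟧) (Nat.lt_succ_iff.1 hd)) d
    (Nat.lt_succ_self d)
  rw [map_sub] at this ⊢
  rw [eulerSeries, coeff_mk]
  linarith

/-! ### A recurrence and its uniqueness -/

/-- By induction on r, every D i m is divisible by X^r. For i ≥ 1 the right side of the recurrence
carries a positive power of X, so it vanishes modulo X^{r+1}; the case i = 0 reads D 1 m = D k
(m+1). Hence D i m ≡ D k (m+1) for all 1 ≤ i ≤ k. In particular D k m does not depend on m modulo
X^{r+1}, and `hlim` at a large m makes it 0. -/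
theorem eq_zero_of_gordon_recurrence {k : ℕ} {D : ℕ → ℕ → ℝ⟦X⟧} (h0 : ∀ m, D 0 m = 0)
    (hrec : ∀ i < k, ∀ m, D (i + 1) m - D i m = X ^ ((m + 1) * i) * D (k - i) (m + 1))
    (hlim : ∀ m, X ^ (m + 1) ∣ D k m) {i : ℕ} (hi : i ≤ k) (m : ℕ) : D i m = 0 := by
  have key : ∀ r, ∀ i ≤ k, ∀ m, X ^ r ∣ D i m := by
    intro r
    induction r with
    | zero => simp
    | succ r ih =>
      have h1 : ∀ i < k, ∀ m, X ^ (r + 1) ∣ D (i + 1) m - D k (m + 1) := by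
        intro i
        induction i with
        | zero =>
          intro hk m
          have := hrec 0 hk m
          simp only [h0, mul_zero, pow_zero, one_mul, sub_zero, Nat.sub_zero] at this
          simp [this]
        | succ i ihi =>
          intro hk m
          have e : D (i + 1 + 1) m - D k (m + 1) = (D (i + 1) m - D k (m + 1)) +
              X ^ ((m + 1) * (i + 1)) * D (k - (i + 1)) (m + 1) := by
            rw [← hrec (i + 1) hk m]; ring
          rw [e]
          refine dvd_add (ihi (by omega) m) ?_
          rw [pow_succ']
          -- One factor X comes from the monomial, as i + 1 > 0, and X^r from the induction
          -- hypothesis.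
          exact mul_dvd_mul (dvd_pow_self _ (by positivity)) (ih _ (by omega) _)
      have h2 : ∀ m, X ^ (r + 1) ∣ D k m := by
        intro m
        rcases Nat.eq_zero_or_pos k with rfl | hk
        · simp [h0]
        have h3 : ∀ t, X ^ (r + 1) ∣ D k m - D k (m + t) := by
          intro t
          induction t with
          | zero => simp
          | succ t iht =>
            have := h1 (k - 1) (by omega) (m + t)
            rw [Nat.sub_add_cancel hk] at this
            simpa [add_assoc] using dvd_add iht this
        have := dvd_add (h3 r) ((pow_dvd_pow X (by omega)).trans (hlim (m + r)))
        simpa using this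
      intro i hi m
      rcases i with _ | i
      · simp [h0]
      · simpa using dvd_add (h1 i hi m) (h2 (m + 1))
  ext d
  exact X_pow_dvd_iff.1 (key (d + 1) i hi m) d (Nat.lt_succ_self d)

/-! ### The multisum side -/

/-- Andrews' function `J_{l+1,i}(0; x; q)` at `x = q^m`, in the form of an iterated sum. -/
noncomputable def andrewsSeries : ℕ → ℕ → ℕ → ℝ⟦X⟧
  | 0, i, _ => if i = 0 then 0 else 1
  | l + 1, i, m => ∑' n : ℕ, X ^ ((l + 1) * (n * m + n ^ 2) + (l + 2 - i) * n) *
      (qPochhammer X n)⁻¹ * andrewsSeries l i (m + 2 * n)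

theorem andrewsSeries_succ (l i m : ℕ) : andrewsSeries (l + 1) i m =
    ∑' n : ℕ, X ^ ((l + 1) * (n * m + n ^ 2) + (l + 2 - i) * n) *
      (qPochhammer X n)⁻¹ * andrewsSeries l i (m + 2 * n) := rfl

theorem summable_andrewsSeries (l m c : ℕ) (g : ℕ → ℝ⟦X⟧) :
    Summable fun n : ℕ => X ^ ((l + 1) * (n * m + n ^ 2) + c * n) * (qPochhammer X n)⁻¹ * g n := by
  refine summable_of_X_pow_dvd fun n => Dvd.dvd.mul_right (Dvd.dvd.mul_right (pow_dvd_pow _ ?_) _) _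
  nlinarith [Nat.le_self_pow (two_ne_zero) n, Nat.zero_le (l * (n * m + n ^ 2)),
    Nat.zero_le (n * m), Nat.zero_le (c * n)]

theorem andrewsSeries_zero (l m : ℕ) : andrewsSeries l 0 m = 0 := by
  induction l generalizing m with
  | zero => simp [andrewsSeries]
  | succ l ih => simp [andrewsSeries_succ, ih]

/-- Once i exceeds the number l of variables, no linear term N_j remains; in the definition the
truncated subtraction is 0. This provides the boundary case i = l + 1 of the recurrence, which its
induction on l needs. -/
theorem andrewsSeries_of_le (l m : ℕ) {i : ℕ} (hi : l + 1 ≤ i) :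
    andrewsSeries l i m = andrewsSeries l (l + 1) m := by
  induction l generalizing m i with
  | zero => simp [andrewsSeries, show i ≠ 0 by omega]
  | succ l ih =>
    rw [andrewsSeries_succ, andrewsSeries_succ]
    refine tsum_congr fun n => ?_
    rw [ih _ (show l + 1 ≤ i by omega), ih _ (show l + 1 ≤ l + 1 + 1 by omega),
      show l + 2 - i = l + 2 - (l + 1 + 1) by omega]

/-- Induction on the number of variables. Writing A for the series with one variable fewer and c = l
+ 1 - i, the n-th terms differ by a multiple of A_{i+1} - X^n A_i = (A_{i+1} - A_i) + (1 - X^n) A_i.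
The first part becomes W by the induction hypothesis at i. The second is V, which vanishes at n = 0
and, shifted by one, loses the last factor of its denominator. Then W n and V (n+1) recombine by the
induction hypothesis at c. -/
theorem andrewsSeries_recurrence (l : ℕ) : ∀ i ≤ l + 1, ∀ m,
    andrewsSeries l (i + 1) m - andrewsSeries l i m =
      X ^ ((m + 1) * i) * andrewsSeries l (l + 1 - i) (m + 1) := by
  induction l with
  | zero =>
    intro i hi m
    interval_cases i <;> simp [andrewsSeries]
  | succ l ih =>
    intro i hi m
    rcases hi.lt_or_eq with hi | rfl
    swap
    · rw [andrewsSeries_of_le (l + 1) m (show l + 1 + 1 ≤ l + 1 + 1 + 1 by omega), sub_self,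
        Nat.sub_self, andrewsSeries_zero, mul_zero]
    obtain ⟨c, hc⟩ : ∃ c, l + 1 = i + c := ⟨l + 1 - i, by omega⟩
    have e1 : l + 2 - (i + 1) = c := by omega
    have e3 : l + 1 + 1 - i = c + 1 := by omega
    have e4 : l + 2 - (c + 1) = i := by omega
    rw [andrewsSeries_succ, andrewsSeries_succ, e3, andrewsSeries_succ, e1, e4]
    set V : ℕ → ℝ⟦X⟧ := fun n => X ^ ((l + 1) * (n * m + n ^ 2) + c * n) * (qPochhammer X n)⁻¹ *
      ((1 - X ^ n) * andrewsSeries l i (m + 2 * n)) with hV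
    set W : ℕ → ℝ⟦X⟧ := fun n => X ^ ((l + 1) * (n * m + n ^ 2) + c * n) * (qPochhammer X n)⁻¹ *
      (X ^ ((m + 2 * n + 1) * i) * andrewsSeries l c (m + 2 * n + 1)) with hW
    have sV : Summable V := summable_andrewsSeries l m c _
    have sW : Summable W := summable_andrewsSeries l m c _
    rw [← (summable_andrewsSeries l m c _).tsum_sub (summable_andrewsSeries l m (c + 1) _),
      ← (summable_andrewsSeries l (m + 1) i _).tsum_mul_left]
    calc _ = ∑' n, (V n + W n) := tsum_congr fun n => by
          have := ih i (by omega) (m + 2 * n)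
          rw [show l + 1 - i = c by omega] at this
          simp only [hV, hW, ← this]
          ring
      _ = ∑' n, (W n + V (n + 1)) := by
          rw [sV.tsum_add sW, sW.tsum_add ((summable_nat_add_iff 1).2 sV), sV.tsum_eq_zero_add]
          simp [hV, add_comm]
      _ = _ := tsum_congr fun n => by
          have h := ih c (by omega) (m + 1 + 2 * n)
          rw [show l + 1 - c = i by omega] at h
          have hG : andrewsSeries l (c + 1) (m + 1 + 2 * n) = andrewsSeries l c (m + 2 * n + 1) +
              X ^ ((m + 1 + 2 * n + 1) * c) * andrewsSeries l i (m + 2 * (n + 1)) := by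
            rw [show m + 2 * n + 1 = m + 1 + 2 * n by ring,
              show m + 2 * (n + 1) = m + 1 + 2 * n + 1 by ring, ← h]
            ring
          have hP := one_sub_X_pow_mul_inv_qPochhammer_succ n
          have hV' : V (n + 1) = X ^ ((l + 1) * ((n + 1) * m + (n + 1) ^ 2) + c * (n + 1)) *
              (qPochhammer X n)⁻¹ * andrewsSeries l i (m + 2 * (n + 1)) := by
            rw [← hP]; simp only [hV]; ring
          rw [hV', hG]
          simp only [hW]
          have x1 : (X : ℝ⟦X⟧) ^ ((l + 1) * (n * m + n ^ 2) + c * n) * X ^ ((m + 2 * n + 1) * i) =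
              X ^ ((m + 1) * i) * X ^ ((l + 1) * (n * (m + 1) + n ^ 2) + i * n) := by
            rw [← pow_add, ← pow_add, hc]; congr 1; ring
          have x2 : (X : ℝ⟦X⟧) ^ ((l + 1) * ((n + 1) * m + (n + 1) ^ 2) + c * (n + 1)) =
              X ^ ((m + 1) * i) * X ^ ((l + 1) * (n * (m + 1) + n ^ 2) + i * n) *
                X ^ ((m + 1 + 2 * n + 1) * c) := by
            rw [← pow_add, ← pow_add, hc]; congr 1; ring
          rw [x2]
          linear_combination (qPochhammer X n)⁻¹ * andrewsSeries l c (m + 2 * n + 1) * x1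

/-- Terms with a positive outer variable have exponent at least m + 1; the term at 0 is the series
with one variable fewer. -/
theorem X_pow_dvd_andrewsSeries_sub_one (l m : ℕ) {i : ℕ} (hi : i ≠ 0) :
    X ^ (m + 1) ∣ andrewsSeries l i m - 1 := by
  induction l generalizing m with
  | zero => simp [andrewsSeries, hi]
  | succ l ih =>
    rw [andrewsSeries_succ, (summable_andrewsSeries l m _ _).tsum_eq_zero_add]
    have h0 : X ^ ((l + 1) * (0 * m + 0 ^ 2) + (l + 2 - i) * 0) * (qPochhammer X 0)⁻¹ *
        andrewsSeries l i (m + 2 * 0) = andrewsSeries l i m := by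
      have := qPochhammer_mul_inv 0
      rw [qPochhammer_zero, one_mul] at this
      simp [qPochhammer_zero, this]
    rw [h0, add_sub_right_comm]
    refine dvd_add (ih m) (X_pow_dvd_tsum ((summable_nat_add_iff 1 (f := fun n : ℕ =>
      X ^ ((l + 1) * (n * m + n ^ 2) + (l + 2 - i) * n) * (qPochhammer X n)⁻¹ *
        andrewsSeries l i (m + 2 * n))).2 (summable_andrewsSeries l m _ _)) fun n => ?_)
    refine Dvd.dvd.mul_right (Dvd.dvd.mul_right (pow_dvd_pow _ ?_) _) _
    nlinarith [Nat.zero_le (l * ((n + 1) * m + (n + 1) ^ 2)), Nat.zero_le (n * m),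
      Nat.zero_le ((l + 2 - i) * (n + 1)), Nat.zero_le (n ^ 2)]

/-! ### The theta series side -/

/-- The numerator of Andrews' function `J_{k,i}(0; x; q)` at `x = q^m`, as a Selberg type series,
the exponent `(2k+1) n(n+1)/2 - i n` being written without subtraction. -/
noncomputable def selbergTerm (k i m n : ℕ) : ℝ⟦X⟧ :=
  (-1) ^ n * X ^ (m * k * n + k * n ^ 2 + (n + 1).choose 2 + (k - i) * n) *
    (1 - X ^ ((m + 2 * n + 1) * i)) * ∏ j ∈ range m, (1 - X ^ (n + 1 + j))

/-- The sum of the Selberg type series with terms `selbergTerm k i m n`. -/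
noncomputable def selbergSeries (k i m : ℕ) : ℝ⟦X⟧ := ∑' n, selbergTerm k i m n

theorem X_pow_dvd_selbergTerm {k i m n d : ℕ}
    (h : d ≤ m * k * n + k * n ^ 2 + (n + 1).choose 2 + (k - i) * n) :
    X ^ d ∣ selbergTerm k i m n := by
  rw [selbergTerm, mul_comm ((-1) ^ n), mul_assoc, mul_assoc]
  exact Dvd.dvd.mul_right (pow_dvd_pow _ h) _

theorem le_choose_succ_two (n : ℕ) : n ≤ (n + 1).choose 2 := by
  rw [Nat.choose_succ_succ' n 1, Nat.choose_one_right]; omega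

theorem summable_selbergTerm (k i m : ℕ) : Summable (selbergTerm k i m) :=
  summable_of_X_pow_dvd fun n => X_pow_dvd_selbergTerm (by have := le_choose_succ_two n; omega)

theorem selbergSeries_zero (k m : ℕ) : selbergSeries k 0 m = 0 := by
  simp [selbergSeries, selbergTerm]

/-- The product p n m in a term is (q)_{n+m}/(q)_n. With M = m + 2n + 1, the difference of the terms
contains (1 - X^{M(i+1)}) - X^n (1 - X^{Mi}) = (1 - X^n) + X^{n+Mi} (1 - X^{m+n+1}). The factor 1 -
X^{m+n+1} extends p at its upper end, giving W; the factor 1 - X^n, after shifting n by one, extends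
it at its lower end, giving V. Both then share p n (m+1) and form one term of the right side. -/
theorem selbergSeries_recurrence {k i : ℕ} (hi : i < k) (m : ℕ) :
    selbergSeries k (i + 1) m - selbergSeries k i m =
      X ^ ((m + 1) * i) * selbergSeries k (k - i) (m + 1) := by
  obtain ⟨c, rfl⟩ : ∃ c, k = i + c + 1 := ⟨k - i - 1, by omega⟩
  have e1 : i + c + 1 - (i + 1) = c := by omega
  have e2 : i + c + 1 - i = c + 1 := by omega
  have e3 : i + c + 1 - (c + 1) = i := by omega
  set k := i + c + 1 with hk
  set p : ℕ → ℕ → ℝ⟦X⟧ := fun n m => ∏ j ∈ range m, (1 - X ^ (n + 1 + j)) with hp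
  have p1 : ∀ n m, p n (m + 1) = p n m * (1 - X ^ (n + 1 + m)) := fun n m => prod_range_succ _ _
  have p2 : ∀ n m, p n (m + 1) = p (n + 1) m * (1 - X ^ (n + 1)) := fun n m => by
    simp only [hp]
    rw [prod_range_succ', add_zero]
    exact congrArg (· * _) (prod_congr rfl fun j _ => by rw [show n + 1 + (j + 1) = n + 1 + 1 + j by ring])
  set E : ℕ → ℕ := fun n => m * k * n + k * n ^ 2 + (n + 1).choose 2 + c * n with hE
  set V : ℕ → ℝ⟦X⟧ := fun n => (-1) ^ n * X ^ E n * ((1 - X ^ n) * p n m) with hV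
  set W : ℕ → ℝ⟦X⟧ := fun n =>
    (-1) ^ n * X ^ (E n + (n + (m + 2 * n + 1) * i)) * p n (m + 1) with hW
  have hEn : ∀ n, n ≤ E n := fun n => by have := le_choose_succ_two n; simp only [hE]; omega
  have sV : Summable V := summable_of_X_pow_dvd fun n =>
    Dvd.dvd.mul_right (Dvd.dvd.mul_left (pow_dvd_pow _ (hEn n)) _) _
  have sW : Summable W := summable_of_X_pow_dvd fun n =>
    Dvd.dvd.mul_right (Dvd.dvd.mul_left (pow_dvd_pow _ ((hEn n).trans (Nat.le_add_right _ _))) _) _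
  rw [selbergSeries, selbergSeries, selbergSeries, e2,
    ← (summable_selbergTerm _ _ _).tsum_sub (summable_selbergTerm _ _ _),
    ← (summable_selbergTerm _ _ _).tsum_mul_left]
  calc _ = ∑' n, (V n + W n) := tsum_congr fun n => by
        have h1 : selbergTerm k (i + 1) m n = (-1) ^ n * X ^ E n *
            (1 - X ^ ((m + 2 * n + 1) * (i + 1))) * p n m := by rw [selbergTerm, e1]
        have h2 : selbergTerm k i m n = (-1) ^ n * X ^ (E n + n) *
            (1 - X ^ ((m + 2 * n + 1) * i)) * p n m := by
          rw [selbergTerm, e2]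
          have : m * k * n + k * n ^ 2 + (n + 1).choose 2 + (c + 1) * n = E n + n := by
            simp only [hE]; ring
          rw [this]
        rw [h1, h2]
        simp only [hV, hW, p1]
        ring
    _ = ∑' n, (W n + V (n + 1)) := by
        rw [sV.tsum_add sW, sW.tsum_add ((summable_nat_add_iff 1).2 sV), sV.tsum_eq_zero_add]
        simp [hV, add_comm]
    _ = _ := tsum_congr fun n => by
        have h1 : selbergTerm k (c + 1) (m + 1) n =
            (-1) ^ n * X ^ ((m + 1) * k * n + k * n ^ 2 + (n + 1).choose 2 + i * n) *
            (1 - X ^ ((m + 1 + 2 * n + 1) * (c + 1))) * p n (m + 1) := by rw [selbergTerm, e3]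
        have h2 : V (n + 1) = (-1) ^ (n + 1) * X ^ E (n + 1) * p n (m + 1) := by
          rw [p2]; simp only [hV]; ring
        rw [h1, h2]
        simp only [hW]
        have x1 : (X : ℝ⟦X⟧) ^ (E n + (n + (m + 2 * n + 1) * i)) = X ^ ((m + 1) * i) *
            X ^ ((m + 1) * k * n + k * n ^ 2 + (n + 1).choose 2 + i * n) := by
          rw [← pow_add]; simp only [hE, hk]; congr 1; ring
        have x2 : (X : ℝ⟦X⟧) ^ E (n + 1) = X ^ ((m + 1) * i) *
            X ^ ((m + 1) * k * n + k * n ^ 2 + (n + 1).choose 2 + i * n) *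
              X ^ ((m + 1 + 2 * n + 1) * (c + 1)) := by
          rw [← pow_add, ← pow_add]; simp only [hE, hk]; congr 1
          rw [Nat.choose_succ_succ' (n + 1) 1, Nat.choose_one_right]; ring
        rw [x1, x2]
        ring

/-- Only n = 0 matters modulo X^{m+1}: that term is (1 - X^{(m+1)i}) (q)_m, and the later exponents
exceed m. -/
theorem X_pow_dvd_selbergSeries_sub_qPochhammer {k i : ℕ} (hi : i ≠ 0) (hk : k ≠ 0) (m : ℕ) :
    X ^ (m + 1) ∣ selbergSeries k i m - qPochhammer X m := by
  rw [selbergSeries, (summable_selbergTerm _ _ _).tsum_eq_zero_add]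
  have h0 : selbergTerm k i m 0 = qPochhammer X m - X ^ ((m + 1) * i) * qPochhammer X m := by
    simp [selbergTerm, qPochhammer, add_comm 1]; ring
  rw [h0]
  have e : ∀ a b c : ℝ⟦X⟧, a - b + c - a = c - b := fun a b c => by ring
  rw [e]
  refine dvd_sub (X_pow_dvd_tsum ((summable_nat_add_iff 1).2 (summable_selbergTerm _ _ _)) fun n =>
    X_pow_dvd_selbergTerm ?_)
    (Dvd.dvd.mul_right (pow_dvd_pow _ (Nat.le_mul_of_pos_right _ (Nat.pos_of_ne_zero hi))) _)
  have h1 : m ≤ m * k * (n + 1) := by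
    rw [mul_assoc]; exact Nat.le_mul_of_pos_right _ (by positivity)
  have := le_choose_succ_two (n + 1)
  omega

/-- Both forms of Andrews' function agree. -/
theorem eulerSeries_mul_andrewsSeries {l i : ℕ} (hi : i ≤ l + 1) (m : ℕ) :
    eulerSeries * andrewsSeries l i m = selbergSeries (l + 1) i m := by
  rw [← sub_eq_zero]
  refine eq_zero_of_gordon_recurrence (k := l + 1)
    (D := fun i m => eulerSeries * andrewsSeries l i m - selbergSeries (l + 1) i m) ?_ ?_ ?_ hi m
  · intro m; rw [andrewsSeries_zero, selbergSeries_zero, mul_zero, sub_zero]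
  · intro i hi m
    linear_combination eulerSeries * andrewsSeries_recurrence l i hi.le m -
      selbergSeries_recurrence hi m
  -- Modulo X^{m+1}, the chain is (q)_∞ A ≡ (q)_∞ ≡ (q)_m ≡ the Selberg series.
  · intro m
    have h1 := (X_pow_dvd_andrewsSeries_sub_one l m (i := l + 1) (by omega)).mul_left eulerSeries
    have h2 := X_pow_dvd_eulerSeries_sub m
    have h3 := X_pow_dvd_selbergSeries_sub_qPochhammer (k := l + 1) (i := l + 1)
      (by omega) (by omega) m
    have := dvd_sub (dvd_add h1 h2) h3
    convert this using 1
    ring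

/-! ### The Gauss binomial theorem -/

/-- The Gaussian binomial coefficient `[r + s; r]` to the base `y`. -/
def gaussBinom {R : Type*} [CommRing R] (y : R) : ℕ → ℕ → R
  | 0, _ => 1
  | _ + 1, 0 => 1
  | r + 1, s + 1 => gaussBinom y r (s + 1) + y ^ (r + 1) * gaussBinom y (r + 1) s

theorem gaussBinom_zero_left {R : Type*} [CommRing R] (y : R) (s : ℕ) : gaussBinom y 0 s = 1 := by
  rw [gaussBinom]

theorem gaussBinom_zero_right {R : Type*} [CommRing R] (y : R) (r : ℕ) : gaussBinom y r 0 = 1 := by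
  cases r <;> rw [gaussBinom]

theorem gaussBinom_succ_succ {R : Type*} [CommRing R] (y : R) (r s : ℕ) :
    gaussBinom y (r + 1) (s + 1) =
      gaussBinom y r (s + 1) + y ^ (r + 1) * gaussBinom y (r + 1) s := by
  rw [gaussBinom]

/-- The quotient formula for Gaussian binomials with the denominators multiplied out, so that it
holds in every commutative ring. -/
theorem gaussBinom_mul_qPochhammer {R : Type*} [CommRing R] (y : R) (r s : ℕ) :
    gaussBinom y r s * (qPochhammer y r * qPochhammer y s) = qPochhammer y (r + s) := by
  induction r generalizing s with
  | zero => simp [gaussBinom_zero_left, qPochhammer_zero]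
  | succ r ihr =>
    induction s with
    | zero => simp [gaussBinom_zero_right, qPochhammer_zero]
    | succ s ihs =>
      have h1 := ihr (s + 1)
      rw [show r + (s + 1) = r + 1 + s by ring] at h1
      rw [gaussBinom_succ_succ, show r + 1 + (s + 1) = r + 1 + s + 1 by ring, qPochhammer_succ y r,
        qPochhammer_succ y (r + 1 + s)]
      rw [qPochhammer_succ y r] at ihs
      rw [qPochhammer_succ y s] at h1 ⊢
      linear_combination (1 - y ^ (r + 1)) * h1 + y ^ (r + 1) * (1 - y ^ (s + 1)) * ihs

/-- Removing the factor x + y at j = 0 leaves the same product with y replaced by yQ; multiplying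
its expansion by x + y reproduces the Pascal recursion. The form homogeneous in x and y later avoids
negative powers. -/
theorem prod_add_mul_pow_eq_sum_gaussBinom {R : Type*} [CommRing R] (Q x y : R) (M : ℕ) :
    ∏ j ∈ range M, (x + y * Q ^ j) = ∑ p ∈ antidiagonal M,
      gaussBinom Q p.1 p.2 * Q ^ (p.1.choose 2) * y ^ p.1 * x ^ p.2 := by
  induction M generalizing y with
  | zero => simp [gaussBinom_zero_left]
  | succ M ih =>
    rw [prod_range_succ']
    have e : ∏ j ∈ range M, (x + y * Q ^ (j + 1)) = ∏ j ∈ range M, (x + y * Q * Q ^ j) :=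
      prod_congr rfl fun j _ => by ring
    rw [e, ih]
    -- `f1` and `f2` are the contributions of y and of x, extended by 0 to the boundary of the
    -- larger antidiagonal.
    set f1 : ℕ × ℕ → R := fun p => match p with
      | (0, _) => 0
      | (r + 1, s) => gaussBinom Q r s * Q ^ ((r + 1).choose 2) * y ^ (r + 1) * x ^ s with hf1
    set f2 : ℕ × ℕ → R := fun p => match p with
      | (_, 0) => 0
      | (r, s + 1) => gaussBinom Q r s * Q ^ (r.choose 2 + r) * y ^ r * x ^ (s + 1) with hf2
    have hch : ∀ r : ℕ, (r + 1).choose 2 = r.choose 2 + r := fun r => by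
      rw [Nat.choose_succ_succ' r 1, Nat.choose_one_right, add_comm]
    have hsum : ∀ p ∈ antidiagonal (M + 1),
        gaussBinom Q p.1 p.2 * Q ^ (p.1.choose 2) * y ^ p.1 * x ^ p.2 = f1 p + f2 p := by
      rintro ⟨_ | r, _ | s⟩ hp
      · simp at hp
      · simp [hf1, hf2, gaussBinom_zero_left]
      · simp [hf1, hf2, gaussBinom_zero_right]
      · simp only [hf1, hf2, gaussBinom_succ_succ, hch]
        ring
    rw [sum_congr rfl hsum, sum_add_distrib, Nat.sum_antidiagonal_succ (f := f1),
      Nat.sum_antidiagonal_succ' (f := f2)]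
    simp only [hf1, hf2, zero_add, pow_zero, mul_one]
    rw [← sum_add_distrib, sum_mul]
    refine sum_congr rfl fun p _ => ?_
    rw [hch, mul_pow]
    ring

/-! ### The Jacobi triple product -/

/-- The finite Jacobi triple product, cleared of denominators. -/
theorem jacobi_triple_product_finite {R : Type*} [CommRing R] (z w : R) (N : ℕ) :
    (-z) ^ N * (z * w) ^ (N.choose 2 + N ^ 2) *
      ∏ j ∈ range N, ((1 - z * (z * w) ^ j) * (1 - w * (z * w) ^ j)) =
    ∑ p ∈ antidiagonal (N + N), gaussBinom (z * w) p.1 p.2 * (z * w) ^ (p.1.choose 2 + N * p.2) *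
      (-z) ^ p.1 := by
  -- Of the 2N factors, the last N give 1 - z(zw)^j after (zw)^N is taken out, and the first N give
  -- 1 - w(zw)^{N-1-j} after -z(zw)^j is taken out.
  have h := prod_add_mul_pow_eq_sum_gaussBinom (z * w) ((z * w) ^ N) (-z) (N + N)
  rw [prod_range_add] at h
  have h1 : ∏ j ∈ range N, ((z * w) ^ N + -z * (z * w) ^ (N + j)) =
      (z * w) ^ (N ^ 2) * ∏ j ∈ range N, (1 - z * (z * w) ^ j) := by
    have e1 : ∏ j ∈ range N, ((z * w) ^ N + -z * (z * w) ^ (N + j)) =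
        ∏ j ∈ range N, ((z * w) ^ N * (1 - z * (z * w) ^ j)) :=
      prod_congr rfl fun j _ => by rw [pow_add]; ring
    rw [e1, prod_mul_distrib, prod_const, card_range, pow_two, pow_mul]
  have h2 : ∏ j ∈ range N, ((z * w) ^ N + -z * (z * w) ^ j) =
      (-z) ^ N * (z * w) ^ (N.choose 2) * ∏ j ∈ range N, (1 - w * (z * w) ^ j) := by
    have e1 : ∏ j ∈ range N, ((z * w) ^ N + -z * (z * w) ^ j) =
        ∏ j ∈ range N, (-z * (z * w) ^ j * (1 - w * (z * w) ^ (N - 1 - j))) := by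
      refine prod_congr rfl fun j hj => ?_
      obtain ⟨t, ht⟩ : ∃ t, N = t + j + 1 := ⟨N - 1 - j, by have := mem_range.1 hj; omega⟩
      rw [show N - 1 - j = t by omega, ht]
      ring
    rw [e1, prod_mul_distrib, prod_mul_distrib, prod_const, card_range,
      prod_range_reflect (fun j => 1 - w * (z * w) ^ j) N, prod_pow_eq_pow_sum,
      sum_range_id, Nat.choose_two_right]
  rw [h1, h2] at h
  rw [prod_mul_distrib]
  calc _ = _ := by rw [pow_add]; ring
    _ = _ := h
    _ = _ := sum_congr rfl fun p _ => by rw [pow_add, pow_mul]; ring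

/-- Let b be the one of r, s that is at least N, and a the other. Then [2N; r] (y)_N (y)_b ≡ [2N; r]
(y)_a (y)_b = (y)_{2N} ≡ (y)_b modulo y^{d+1}, and the unit (y)_b cancels. -/
theorem dvd_gaussBinom_mul_qPochhammer_sub_one {y : ℝ⟦X⟧} (hy : constantCoeff y = 0) {N r s d : ℕ}
    (hrs : r + s = N + N) (hr : d ≤ r) (hs : d ≤ s) :
    y ^ (d + 1) ∣ gaussBinom y r s * qPochhammer y N - 1 := by
  have hu : ∀ n, IsUnit (qPochhammer y n) := fun n =>
    isUnit_iff_constantCoeff.2 (by simp [constantCoeff_qPochhammer hy])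
  have key : ∀ a b, a + b = N + N → d ≤ a → N ≤ b → gaussBinom y r s * (qPochhammer y a *
      qPochhammer y b) = qPochhammer y (N + N) →
      y ^ (d + 1) ∣ gaussBinom y r s * qPochhammer y N - 1 := by
    intro a b hab ha hb h
    have h1 := dvd_qPochhammer_sub_qPochhammer y (show b ≤ N + N by omega)
    have h2 := dvd_qPochhammer_sub_qPochhammer y (show a ≤ N by omega)
    have h1' := (pow_dvd_pow y (show d + 1 ≤ b + 1 by omega)).trans h1
    have h2' := (pow_dvd_pow y (show d + 1 ≤ a + 1 by omega)).trans h2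
    rw [← (hu b).dvd_mul_right]
    convert dvd_add h1' (h2'.mul_left (gaussBinom y r s * qPochhammer y b)) using 1
    rw [← h]
    ring
  have hg := gaussBinom_mul_qPochhammer y r s
  rw [hrs] at hg
  rcases le_total N s with h | h
  · exact key r s hrs hr h hg
  · exact key s r (by omega) hs (by omega) (by rw [mul_comm (qPochhammer y s)]; exact hg)

theorem two_mul_choose_two_add (n : ℕ) : 2 * n.choose 2 + n = n ^ 2 := by
  induction n with
  | zero => simp
  | succ n ih =>
    rw [Nat.choose_succ_succ' n 1, Nat.choose_one_right]
    nlinarith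

theorem choose_succ_two (n : ℕ) : (n + 1).choose 2 = n.choose 2 + n := by
  rw [Nat.choose_succ_succ' n 1, Nat.choose_one_right, add_comm]

theorem choose_add_two (a n : ℕ) : (a + n).choose 2 = a.choose 2 + n.choose 2 + a * n := by
  have h1 := two_mul_choose_two_add (a + n)
  have h2 := two_mul_choose_two_add a
  have h3 := two_mul_choose_two_add n
  nlinarith

/-- The Jacobi triple product modulo a power of `q`, for the theta series of the Gordon
identities. -/
theorem X_pow_dvd_selbergSeries_sub_prod {k i : ℕ} (hk : k ≠ 0) (hi : i ≠ 0) (hik : i ≤ k) (N : ℕ) :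
    X ^ (N + 1) ∣ selbergSeries k i 0 - ∏ j ∈ range N, ((1 - X ^ ((2 * k + 1) * (j + 1))) *
      ((1 - X ^ (i + (2 * k + 1) * j)) * (1 - X ^ (2 * k + 1 - i + (2 * k + 1) * j)))) := by
  obtain ⟨c, rfl⟩ : ∃ c, k = i + c := ⟨k - i, by omega⟩
  set k := i + c with hkc
  have hw : 2 * k + 1 - i = i + c + c + 1 := by omega
  rw [hw]
  set Q : ℝ⟦X⟧ := X ^ (2 * k + 1) with hQ
  have hQ0 : constantCoeff Q = 0 := by simp [hQ]
  -- The triple product is applied with z = q^i and w = q^{2k+1-i}, so that zw = q^{2k+1}.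
  have hzw : (X : ℝ⟦X⟧) ^ i * X ^ (i + c + c + 1) = Q := by
    rw [← pow_add, hQ]; congr 1; omega
  -- Expanding 1 - X^{(2n+1)i} in the n-th term of the theta series gives the exponents `e n` and
  -- `e' n`, the two halves of the bilateral sum. The number `E` below is the power of q on the left
  -- of the finite identity.
  set e : ℕ → ℕ := fun n => k * n ^ 2 + (n + 1).choose 2 + c * n with he
  set e' : ℕ → ℕ := fun n => e n + (2 * n + 1) * i with he'
  have hprod : ∏ j ∈ range N, ((1 - (X : ℝ⟦X⟧) ^ ((2 * k + 1) * (j + 1))) *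
      ((1 - X ^ (i + (2 * k + 1) * j)) * (1 - X ^ (i + c + c + 1 + (2 * k + 1) * j)))) =
      qPochhammer Q N * ∏ j ∈ range N, ((1 - X ^ i * Q ^ j) * (1 - X ^ (i + c + c + 1) * Q ^ j)) := by
    rw [qPochhammer, ← prod_mul_distrib]
    refine prod_congr rfl fun j _ => ?_
    simp only [hQ, pow_add, pow_mul]
  set E := i * N + (2 * k + 1) * (N.choose 2 + N ^ 2) with hE
  have hfin := jacobi_triple_product_finite ((X : ℝ⟦X⟧) ^ i) (X ^ (i + c + c + 1)) N
  rw [hzw] at hfin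
  set P := ∏ j ∈ range N, ((1 - (X : ℝ⟦X⟧) ^ i * Q ^ j) * (1 - X ^ (i + c + c + 1) * Q ^ j)) with hP
  -- the finite identity, with the powers of `q` cancelled
  have hfin' : P = ∑ n ∈ range (N + 1), gaussBinom Q (N - n) (N + n) * ((-1) ^ n * X ^ e n) -
      ∑ n ∈ range N, gaussBinom Q (N + 1 + n) (N - 1 - n) * ((-1) ^ n * X ^ e' n) := by
    have hX : (-1) ^ N * (X : ℝ⟦X⟧) ^ E ≠ 0 :=
      mul_ne_zero (pow_ne_zero _ (by norm_num)) (pow_ne_zero _ X_ne_zero)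
    refine mul_left_cancel₀ hX ?_
    have hL : (-(X : ℝ⟦X⟧) ^ i) ^ N * Q ^ (N.choose 2 + N ^ 2) = (-1) ^ N * X ^ E := by
      rw [neg_pow, hQ, ← pow_mul, ← pow_mul, mul_assoc, ← pow_add]
    -- The sum over r + s = 2N is split after r = N: the indices r = N - n produce `e n`, the
    -- indices r = N + 1 + n produce `e' n`.
    rw [← hL, hfin, Nat.sum_antidiagonal_eq_sum_range_succ_mk,
      show (N + N).succ = N + 1 + N by omega, sum_range_add,
      ← sum_range_reflect _ (N + 1), hL, mul_sub, mul_sum, mul_sum, sub_eq_add_neg, ← sum_neg_distrib]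
    congr 1
    · refine sum_congr rfl fun n hn => ?_
      obtain ⟨a, rfl⟩ : ∃ a, N = a + n := ⟨N - n, by have := mem_range.1 hn; omega⟩
      rw [show a + n + 1 - 1 - n = a by omega, show a + n - n = a by omega,
        show a + n + (a + n) - a = a + n + n by omega]
      have x1 : Q ^ (a.choose 2 + (a + n) * (a + n + n)) * (-(X : ℝ⟦X⟧) ^ i) ^ a =
          (-1) ^ (a + n) * (-1) ^ n * (X ^ E * X ^ e n) := by
        have s1 : ((-1 : ℝ⟦X⟧)) ^ (a + n) * (-1) ^ n = (-1) ^ a := by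
          rw [← pow_add, add_assoc, pow_add, ← two_mul, pow_mul]; simp
        rw [s1, neg_pow, hQ, ← pow_mul, ← pow_mul, mul_left_comm, ← pow_add, ← pow_add]
        congr 2
        simp only [hE, he, choose_add_two, choose_succ_two]
        have := two_mul_choose_two_add n
        have h2 : (k + 1) * (2 * n.choose 2 + n) = (k + 1) * n ^ 2 := by rw [this]
        rw [hkc] at h2 ⊢
        ring_nf at h2 ⊢
        linarith
      calc _ = gaussBinom Q a (a + n + n) *
            (Q ^ (a.choose 2 + (a + n) * (a + n + n)) * (-(X : ℝ⟦X⟧) ^ i) ^ a) := by ring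
        _ = _ := by rw [x1]; ring
    · refine sum_congr rfl fun n hn => ?_
      obtain ⟨a, rfl⟩ : ∃ a, N = a + 1 + n := ⟨N - 1 - n, by have := mem_range.1 hn; omega⟩
      rw [show a + 1 + n - 1 - n = a by omega,
        show a + 1 + n + (a + 1 + n) - (a + 1 + n + 1 + n) = a by omega]
      have x1 : Q ^ ((a + 1 + n + 1 + n).choose 2 + (a + 1 + n) * a) *
          (-(X : ℝ⟦X⟧) ^ i) ^ (a + 1 + n + 1 + n) =
          -((-1) ^ (a + 1 + n) * (-1) ^ n * (X ^ E * X ^ e' n)) := by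
        have s1 : ((-1 : ℝ⟦X⟧)) ^ (a + 1 + n + 1 + n) = - ((-1) ^ (a + 1 + n) * (-1) ^ n) := by
          ring
        rw [neg_pow, s1, hQ, ← pow_mul, ← pow_mul, mul_left_comm, ← pow_add (X : ℝ⟦X⟧),
          ← pow_add (X : ℝ⟦X⟧), neg_mul]
        congr 3
        have h1 := choose_add_two (a + 1 + n) (n + 1)
        rw [← add_assoc, add_right_comm _ n 1, choose_succ_two n] at h1
        have h2 : k * (2 * n.choose 2 + n) = k * n ^ 2 := by rw [two_mul_choose_two_add n]
        simp only [hE, he', he, h1, choose_succ_two n]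
        rw [hkc] at h2 ⊢
        linear_combination h2
      calc _ = gaussBinom Q (a + 1 + n + 1 + n) a *
            (Q ^ ((a + 1 + n + 1 + n).choose 2 + (a + 1 + n) * a) *
              (-(X : ℝ⟦X⟧) ^ i) ^ (a + 1 + n + 1 + n)) := by ring
        _ = _ := by rw [x1]; ring
  have hk1 : 1 ≤ k := by omega
  have hge : ∀ n, n ≤ (n + 1).choose 2 := le_choose_succ_two
  have hee : ∀ n, n + k * n ^ 2 ≤ e n := fun n => by
    have := hge n
    simp only [he]; omega
  have hS : X ^ (N + 1) ∣ selbergSeries k i 0 - (∑ n ∈ range (N + 1), (-1) ^ n * X ^ e n -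
      ∑ n ∈ range N, (-1) ^ n * X ^ e' n) := by
    have hterm : ∀ n, selbergTerm k i 0 n = (-1) ^ n * X ^ e n - (-1) ^ n * X ^ e' n := fun n => by
      simp only [selbergTerm, he, he', range_zero, prod_empty, hkc,
        show i + c - i = c by omega]
      ring
    rw [selbergSeries, ← (summable_selbergTerm k i 0).sum_add_tsum_nat_add (N + 1)]
    -- The finite identity has one term fewer in its second half; the unmatched `e' N` is at least N
    -- + 1, so its term is negligible.
    have hsum : ∑ n ∈ range (N + 1), selbergTerm k i 0 n =
        ∑ n ∈ range (N + 1), (-1) ^ n * X ^ e n - ∑ n ∈ range N, (-1) ^ n * X ^ e' n -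
          (-1) ^ N * X ^ e' N := by
      rw [sum_congr rfl fun n _ => hterm n, sum_sub_distrib, sum_range_succ _ N,
        sum_range_succ (fun n => (-1 : ℝ⟦X⟧) ^ n * X ^ e' n) N]
      ring
    rw [hsum]
    have e : ∀ a b c : ℝ⟦X⟧, a - b + c - a = c - b := fun a b c => by ring
    rw [e]
    refine dvd_sub (X_pow_dvd_tsum ((summable_nat_add_iff (N + 1)).2 (summable_selbergTerm k i 0))
      fun n => X_pow_dvd_selbergTerm ?_) (Dvd.dvd.mul_left (pow_dvd_pow _ ?_) _)
    · have := hge (n + (N + 1))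
      omega
    · have h1 := hee N
      have h2 : 1 ≤ (2 * N + 1) * i := Nat.mul_pos (by omega) (Nat.pos_of_ne_zero hi)
      simp only [he']
      have := Nat.zero_le (k * N ^ 2)
      omega
  -- The Gaussian binomial times (Q)_N is 1 up to an error divisible by X^{d+1}. It becomes small
  -- only away from the ends of the sum, but there the monomial X^f supplies the missing X^n.
  have hcong : ∀ n d r s, r + s = N + N → d ≤ r → d ≤ s → N ≤ n + d →
      ∀ f, n ≤ f → ∀ u : ℝ⟦X⟧,
      X ^ (N + 1) ∣ u * X ^ f - qPochhammer Q N * (gaussBinom Q r s * (u * X ^ f)) := by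
    intro n d r s hrs hr hs hnd f hf u
    have h1 := dvd_gaussBinom_mul_qPochhammer_sub_one hQ0 hrs hr hs
    have h2 : (X : ℝ⟦X⟧) ^ (d + 1) ∣ Q ^ (d + 1) := by
      rw [hQ, ← pow_mul]; exact pow_dvd_pow _ (Nat.le_mul_of_pos_left _ (by omega))
    have h3 := mul_dvd_mul (h2.trans h1) (pow_dvd_pow (X : ℝ⟦X⟧) hf)
    rw [← pow_add] at h3
    have h4 := ((pow_dvd_pow X (show N + 1 ≤ d + 1 + n by omega)).trans h3).mul_left (-u)
    convert h4 using 1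
    ring
  rw [hprod, hfin']
  have h1 : X ^ (N + 1) ∣ (∑ n ∈ range (N + 1), (-1) ^ n * X ^ e n) - qPochhammer Q N *
      ∑ n ∈ range (N + 1), gaussBinom Q (N - n) (N + n) * ((-1) ^ n * X ^ e n) := by
    rw [mul_sum, ← sum_sub_distrib]
    refine dvd_sum fun n hn => ?_
    have := mem_range.1 hn
    have := hee n
    exact hcong n (N - n) _ _ (by omega) (by omega) (by omega) (by omega) _ (by omega) _
  have h2 : X ^ (N + 1) ∣ (∑ n ∈ range N, (-1) ^ n * X ^ e' n) - qPochhammer Q N *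
      ∑ n ∈ range N, gaussBinom Q (N + 1 + n) (N - 1 - n) * ((-1) ^ n * X ^ e' n) := by
    rw [mul_sum, ← sum_sub_distrib]
    refine dvd_sum fun n hn => ?_
    have := mem_range.1 hn
    have := hee n
    have h2 : 1 ≤ (2 * n + 1) * i := Nat.mul_pos (by omega) (Nat.pos_of_ne_zero hi)
    exact hcong (n + 1) (N - 1 - n) _ _ (by omega) (by omega) (by omega) (by omega) _
      (by simp only [he']; omega) _
  convert dvd_add hS (dvd_sub h1 h2) using 1
  ring

/-! ### The product side of the Gordon identities for power series -/

theorem gordonAdmissible_add_mul (k i n j : ℕ) :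
    GordonAdmissible k i (n + (2 * k + 1) * j) ↔ GordonAdmissible k i n := by
  have h : ((n + (2 * k + 1) * j : ℕ) : ℤ) ≡ n [ZMOD 2 * k + 1] := by
    push_cast
    exact Int.modEq_iff_dvd.2 ⟨-j, by ring⟩
  have key : ∀ c : ℤ, ((n + (2 * k + 1) * j : ℕ) : ℤ) ≡ c [ZMOD 2 * k + 1] ↔
      (n : ℤ) ≡ c [ZMOD 2 * k + 1] := fun c => ⟨fun h' => h.symm.trans h', fun h' => h.trans h'⟩
  rw [GordonAdmissible, GordonAdmissible, key, key, key]

/-- In the complete residue system 1, …, 2k+1 the classes 0, i, -i are represented by 2k+1, i and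
2k+1-i; the index r is one less. -/
theorem not_gordonAdmissible_iff {k i r : ℕ} (hi : 1 ≤ i) (hik : i ≤ k) (hr : r < 2 * k + 1) :
    ¬ GordonAdmissible k i (r + 1) ↔ r = 2 * k ∨ r = i - 1 ∨ r = 2 * k - i := by
  have key : ∀ c : ℤ, 0 ≤ c → c ≤ 2 * k → (((r + 1 : ℕ) : ℤ) ≡ c [ZMOD 2 * k + 1] ↔
      (r : ℤ) + 1 = c ∨ (r : ℤ) + 1 = c + (2 * k + 1)) := by
    intro c h0 h1
    constructor
    · intro h
      obtain ⟨t, ht⟩ := Int.modEq_iff_dvd.1 h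
      push_cast at ht
      have t1 : t ≤ 0 := by
        by_contra h
        nlinarith [show (1 : ℤ) ≤ t by omega]
      have t2 : -1 ≤ t := by
        by_contra h
        nlinarith [show t ≤ -2 by omega, (by exact_mod_cast hr : (r : ℤ) < 2 * k + 1)]
      obtain rfl | rfl : t = 0 ∨ t = -1 := by omega
      · left; linarith
      · right; linarith
    · rintro (h | h)
      · exact Int.modEq_iff_dvd.2 ⟨0, by push_cast; linarith⟩
      · exact Int.modEq_iff_dvd.2 ⟨-1, by push_cast; linarith⟩
  have hneg : ((r + 1 : ℕ) : ℤ) ≡ -i [ZMOD 2 * k + 1] ↔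
      ((r + 1 : ℕ) : ℤ) ≡ 2 * k + 1 - i [ZMOD 2 * k + 1] := by
    have : (-i : ℤ) ≡ 2 * k + 1 - i [ZMOD 2 * k + 1] := Int.modEq_iff_dvd.2 ⟨1, by ring⟩
    exact ⟨fun h => h.trans this, fun h => h.trans this.symm⟩
  rw [GordonAdmissible, hneg, key 0 le_rfl (by omega), key i (by omega) (by omega),
    key (2 * k + 1 - i) (by omega) (by omega)]
  omega

open Classical in
/-- Separating the residue classes `0`, `i` and `-i` modulo `2k+1` from the other ones. -/
theorem prod_range_eq_prod_mul_prod_gordonAdmissible {M : Type*} [CommMonoid M] {k i : ℕ}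
    (hi : 1 ≤ i) (hik : i ≤ k) (f : ℕ → M) (N : ℕ) :
    ∏ n ∈ range ((2 * k + 1) * N), f (n + 1) =
      (∏ j ∈ range N, (f ((2 * k + 1) * (j + 1)) *
        (f (i + (2 * k + 1) * j) * f (2 * k + 1 - i + (2 * k + 1) * j)))) *
      ∏ n ∈ range ((2 * k + 1) * N) with GordonAdmissible k i (n + 1), f (n + 1) := by
  have hblock : ∀ j, ∏ r ∈ range (2 * k + 1),
      (if ¬ GordonAdmissible k i ((2 * k + 1) * j + r + 1) then f ((2 * k + 1) * j + r + 1) else 1) =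
      f ((2 * k + 1) * (j + 1)) *
        (f (i + (2 * k + 1) * j) * f (2 * k + 1 - i + (2 * k + 1) * j)) := by
    intro j
    have hper : ∀ r, GordonAdmissible k i ((2 * k + 1) * j + r + 1) ↔
        GordonAdmissible k i (r + 1) := fun r => by
      rw [← gordonAdmissible_add_mul k i (r + 1) j]
      ring_nf
    simp only [hper]
    rw [← prod_filter]
    have hset : (range (2 * k + 1)).filter (fun r => ¬ GordonAdmissible k i (r + 1)) =
        {2 * k, i - 1, 2 * k - i} := by
      ext r
      simp only [mem_filter, mem_range, mem_insert, mem_singleton]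
      constructor
      · rintro ⟨h1, h2⟩
        exact (not_gordonAdmissible_iff hi hik h1).1 h2
      · intro h
        have h1 : r < 2 * k + 1 := by omega
        exact ⟨h1, (not_gordonAdmissible_iff hi hik h1).2 h⟩
    rw [hset, prod_insert (by simp only [mem_insert, mem_singleton]; omega),
      prod_insert (by simp only [mem_singleton]; omega), prod_singleton]
    refine congrArg₂ _ (congrArg f (by ring)) ?_
    generalize (2 * k + 1) * j = t
    exact congrArg₂ _ (congrArg f (by omega)) (congrArg f (by omega))
  have hbad : ∏ n ∈ range ((2 * k + 1) * N) with ¬ GordonAdmissible k i (n + 1), f (n + 1) =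
      ∏ j ∈ range N, (f ((2 * k + 1) * (j + 1)) *
        (f (i + (2 * k + 1) * j) * f (2 * k + 1 - i + (2 * k + 1) * j))) := by
    rw [prod_filter]
    induction N with
    | zero => simp
    | succ N ih => rw [mul_add_one, prod_range_add, ih, hblock, prod_range_succ]
  rw [← hbad, mul_comm (∏ n ∈ range ((2 * k + 1) * N) with ¬ GordonAdmissible k i (n + 1), f (n + 1)),
    prod_filter_mul_prod_filter_not]

open Classical in
/-- The Gordon identity modulo a power of `q`. -/
theorem X_pow_dvd_andrewsSeries_mul_prod_sub_one {l i : ℕ} (hi : 1 ≤ i) (hil : i ≤ l + 1) (N : ℕ) :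
    X ^ (N + 1) ∣ andrewsSeries l i 0 *
      (∏ n ∈ range ((2 * (l + 1) + 1) * N) with GordonAdmissible (l + 1) i (n + 1),
        (1 - X ^ (n + 1))) - 1 := by
  set M := (2 * (l + 1) + 1) * N with hM
  have hNM : N ≤ M := Nat.le_mul_of_pos_left _ (by omega)
  have h1 := X_pow_dvd_selbergSeries_sub_prod (k := l + 1) (by omega) (by omega) hil N
  rw [← eulerSeries_mul_andrewsSeries hil] at h1
  have h2 := (pow_dvd_pow (X : ℝ⟦X⟧) (show N + 1 ≤ M + 1 by omega)).trans
    (X_pow_dvd_eulerSeries_sub M)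
  have h3 := prod_range_eq_prod_mul_prod_gordonAdmissible hi hil (fun n => 1 - (X : ℝ⟦X⟧) ^ n) N
  rw [← hM] at h3
  set A := ∏ n ∈ range M with GordonAdmissible (l + 1) i (n + 1), (1 - (X : ℝ⟦X⟧) ^ (n + 1))
  set B := ∏ j ∈ range N, ((1 - (X : ℝ⟦X⟧) ^ ((2 * (l + 1) + 1) * (j + 1))) *
    ((1 - X ^ (i + (2 * (l + 1) + 1) * j)) *
      (1 - X ^ (2 * (l + 1) + 1 - i + (2 * (l + 1) + 1) * j))))
  -- With J the Andrews series, modulo X^{N+1} the triple product gives (q)_∞ J ≡ B, while (q)_∞ ≡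
  -- (q)_M = B A. Hence B A J ≡ B, and B is a unit.
  have h4 : qPochhammer (X : ℝ⟦X⟧) M = B * A := h3
  have hBu : IsUnit B := by
    have : IsUnit (B * A) := h4 ▸ isUnit_iff_constantCoeff.2 (by simp [constantCoeff_qPochhammer])
    exact isUnit_of_mul_isUnit_left this
  rw [← hBu.dvd_mul_left]
  rw [h4] at h2
  convert dvd_sub h1 (h2.mul_right (andrewsSeries l i 0)) using 1
  ring

/-! ### The multisum -/

theorem gordonN_eq_sum_ite {l : ℕ} (n : Fin l → ℕ) (j : Fin l) :
    gordonN (k := l + 1) n j = ∑ r : Fin l, if j ≤ r then n r else 0 := by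
  rw [← sum_filter]
  exact sum_congr (by ext; simp) fun _ _ => rfl

/-- The last variable is a summand of every N_j, which is why the multisum is peeled from that end.
-/
theorem gordonN_snoc_castSucc {l : ℕ} (n : Fin l → ℕ) (a : ℕ) (j : Fin l) :
    gordonN (k := l + 2) (Fin.snoc n a : Fin (l + 1) → ℕ) j.castSucc =
      gordonN (k := l + 1) n j + a := by
  rw [gordonN_eq_sum_ite, gordonN_eq_sum_ite, Fin.sum_univ_castSucc]
  simp [Fin.le_last]

theorem gordonN_snoc_last {l : ℕ} (n : Fin l → ℕ) (a : ℕ) :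
    gordonN (k := l + 2) (Fin.snoc n a : Fin (l + 1) → ℕ) (Fin.last l) = a := by
  rw [gordonN_eq_sum_ite, Fin.sum_univ_castSucc]
  simp [Fin.last_le_iff, Fin.castSucc_ne_last]

/-- The terms of the Gordon multisum with `l = k - 1` variables at `x = q^m`, as power series. -/
noncomputable def gordonSeriesTerm (l i m : ℕ) (n : Fin l → ℕ) : ℝ⟦X⟧ :=
  X ^ (gordonExponent (k := l + 1) i n + m * ∑ j : Fin l, gordonN (k := l + 1) n j) *
    ∏ j, (qPochhammer X (n j))⁻¹

/-- This bound leaves only finitely many tuples contributing to a given coefficient. -/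
theorem le_gordonExponent {l : ℕ} (i : ℕ) (n : Fin l → ℕ) (j : Fin l) :
    n j ≤ gordonExponent (k := l + 1) i n := by
  have h1 : n j ≤ gordonN (k := l + 1) n j :=
    single_le_sum (f := n) (fun _ _ => Nat.zero_le _) (mem_Ici.2 le_rfl)
  have h2 : gordonN (k := l + 1) n j ^ 2 ≤ ∑ j : Fin l, gordonN (k := l + 1) n j ^ 2 :=
    single_le_sum (f := fun j => gordonN (k := l + 1) n j ^ 2) (fun _ _ => Nat.zero_le _)
      (mem_univ j)
  exact (h1.trans (Nat.le_self_pow two_ne_zero _)).trans (h2.trans (Nat.le_add_right _ _))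

theorem summable_gordonSeriesTerm (l i m : ℕ) : Summable (gordonSeriesTerm l i m) := by
  rw [WithPiTopology.summable_iff_summable_coeff]
  intro d
  refine summable_of_hasFiniteSupport
    ((Set.Finite.pi' fun _ : Fin l => Set.finite_Iic d).subset fun n hn j => ?_)
  by_contra hlt
  refine hn (X_pow_dvd_iff.1 (Dvd.intro _ rfl : _ ∣ gordonSeriesTerm l i m n) d ?_)
  have := le_gordonExponent i n j
  have : d < n j := not_le.1 hlt
  omega

theorem card_filter_le_val_add_one (l i : ℕ) :
    #(univ.filter fun j : Fin l => i ≤ (j : ℕ) + 1) = l - (i - 1) := by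
  rw [card_filter, Fin.sum_univ_eq_sum_range (fun j => if i ≤ j + 1 then 1 else 0) l]
  induction l with
  | zero => simp
  | succ l ih =>
    rw [sum_range_succ, ih]
    split_ifs <;> omega

/-- Replacing N_j by N_j + a turns N_j² into N_j² + 2aN_j + a². The cross terms are absorbed by
passing from m to m + 2a, which is the reason for carrying the parameter x = q^m. The linear part
contributes a once for each of the l + 2 - i indices from i to l + 1, a count that needs i ≥ 1. -/
theorem gordonSeriesTerm_snoc {l i : ℕ} (hi : i ≠ 0) (m : ℕ) (n : Fin l → ℕ) (a : ℕ) :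
    gordonSeriesTerm (l + 1) i m (Fin.snoc n a : Fin (l + 1) → ℕ) =
      X ^ ((l + 1) * (a * m + a ^ 2) + (l + 2 - i) * a) * (qPochhammer X a)⁻¹ *
        gordonSeriesTerm l i (m + 2 * a) n := by
  have hE : gordonExponent (k := l + 2) i (Fin.snoc n a : Fin (l + 1) → ℕ) +
      m * ∑ j : Fin (l + 1), gordonN (k := l + 2) (Fin.snoc n a : Fin (l + 1) → ℕ) j =
      ((l + 1) * (a * m + a ^ 2) + (l + 2 - i) * a) +
        (gordonExponent (k := l + 1) i n + (m + 2 * a) * ∑ j : Fin l, gordonN (k := l + 1) n j) := by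
    have h1 : ∑ j : Fin (l + 1), gordonN (k := l + 2) (Fin.snoc n a : Fin (l + 1) → ℕ) j =
        (∑ j : Fin l, gordonN (k := l + 1) n j) + (l + 1) * a := by
      rw [Fin.sum_univ_castSucc]
      simp only [gordonN_snoc_castSucc, gordonN_snoc_last, sum_add_distrib, sum_const, card_univ,
        Fintype.card_fin, smul_eq_mul]
      ring
    have h2 : ∑ j : Fin (l + 1), gordonN (k := l + 2) (Fin.snoc n a : Fin (l + 1) → ℕ) j ^ 2 =
        (∑ j : Fin l, gordonN (k := l + 1) n j ^ 2) +
          2 * a * (∑ j : Fin l, gordonN (k := l + 1) n j) + (l + 1) * a ^ 2 := by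
      rw [Fin.sum_univ_castSucc]
      simp only [gordonN_snoc_castSucc, gordonN_snoc_last, add_sq, sum_add_distrib, sum_const,
        card_univ, Fintype.card_fin, smul_eq_mul, mul_sum]
      rw [sum_congr rfl fun (j : Fin l) _ =>
        show 2 * gordonN (k := l + 1) n j * a = 2 * a * gordonN (k := l + 1) n j by ring]
      ring
    have h3 : ∑ j ∈ univ.filter (fun j : Fin (l + 1) => i ≤ (j : ℕ) + 1),
          gordonN (k := l + 2) (Fin.snoc n a : Fin (l + 1) → ℕ) j =
        (∑ j ∈ univ.filter (fun j : Fin l => i ≤ (j : ℕ) + 1), gordonN (k := l + 1) n j) + (l + 2 - i) * a := by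
      have hc : ∑ j ∈ univ.filter (fun j : Fin (l + 1) => i ≤ (j : ℕ) + 1), a = (l + 2 - i) * a := by
        rw [sum_const, card_filter_le_val_add_one, smul_eq_mul, show l + 1 - (i - 1) = l + 2 - i by omega]
      rw [← hc, sum_filter, sum_filter, sum_filter, Fin.sum_univ_castSucc, Fin.sum_univ_castSucc,
        ← add_assoc, ← sum_add_distrib]
      congr 1
      · refine sum_congr rfl fun j _ => ?_
        rw [gordonN_snoc_castSucc, Fin.val_castSucc]
        split_ifs <;> rfl
      · rw [gordonN_snoc_last]
    have e1 : gordonExponent (k := l + 2) i (Fin.snoc n a : Fin (l + 1) → ℕ) =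
      (∑ j : Fin (l + 1), gordonN (k := l + 2) (Fin.snoc n a : Fin (l + 1) → ℕ) j ^ 2) +
      ∑ j ∈ univ.filter (fun j : Fin (l + 1) => i ≤ (j : ℕ) + 1),
          gordonN (k := l + 2) (Fin.snoc n a : Fin (l + 1) → ℕ) j := rfl
    have e2 : gordonExponent (k := l + 1) i n =
      (∑ j : Fin l, gordonN (k := l + 1) n j ^ 2) +
      ∑ j ∈ univ.filter (fun j : Fin l => i ≤ (j : ℕ) + 1), gordonN (k := l + 1) n j := rfl
    rw [e1, e2, h1, h2, h3]
    ring
  have hP : ∏ j : Fin (l + 1), (qPochhammer (X : ℝ⟦X⟧) ((Fin.snoc n a : Fin (l + 1) → ℕ) j))⁻¹ =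
      (∏ j, (qPochhammer X (n j))⁻¹) * (qPochhammer X a)⁻¹ := by
    rw [Fin.prod_univ_castSucc]
    simp
  rw [gordonSeriesTerm, gordonSeriesTerm, hP]
  erw [hE]
  rw [pow_add]
  ring

/-- The iterated sum is the multisum. -/
theorem hasSum_gordonSeriesTerm {l i : ℕ} (hi : i ≠ 0) (m : ℕ) :
    HasSum (gordonSeriesTerm l i m) (andrewsSeries l i m) := by
  induction l generalizing m with
  | zero =>
    have h : gordonSeriesTerm 0 i m default = andrewsSeries 0 i m := by
      simp [gordonSeriesTerm, andrewsSeries, hi, gordonExponent]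
    rw [← h]
    exact hasSum_unique _
  | succ l ih =>
    -- Summability of the whole family allows summing over the first l variables for each fixed
    -- value of the last one.
    have h1 := (Fin.snocEquiv (fun _ : Fin (l + 1) => ℕ)).hasSum_iff.2
      (summable_gordonSeriesTerm (l + 1) i m).hasSum
    have h2 : ∀ a, HasSum (fun n : Fin l → ℕ => gordonSeriesTerm (l + 1) i m
        (Fin.snoc n a : Fin (l + 1) → ℕ)) (X ^ ((l + 1) * (a * m + a ^ 2) + (l + 2 - i) * a) *
          (qPochhammer X a)⁻¹ * andrewsSeries l i (m + 2 * a)) := fun a => by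
      simp only [gordonSeriesTerm_snoc hi]
      exact (ih _).mul_left _
    have h3 := h1.prod_fiberwise h2
    rw [andrewsSeries_succ, h3.tsum_eq]
    exact (summable_gordonSeriesTerm (l + 1) i m).hasSum

/-! ### Infinite products of formal `q`-sums modulo the exponents that are not summands of `δ` -/

namespace FormalQSum

section Ideal

variable {H : Type*} [AddCommMonoid H] [Finset.HasAntidiagonal H]

/-- The ideal of the formal `q`-sums in which no summand of `δ` occurs as an exponent. -/
def summandIdeal (δ : H) : Ideal (FormalQSum H) where
  carrier := {f | ∀ β, (∃ β', β + β' = δ) → f.coeff β = 0}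
  zero_mem' β _ := coeff_zero β
  add_mem' {f g} hf hg β hβ := by rw [coeff_add, hf β hβ, hg β hβ, add_zero]
  -- A summand of a summand of δ is again a summand of δ; this makes the set an ideal.
  smul_mem' g f hf β hβ := by
    rw [smul_eq_mul, coeff_mul]
    refine sum_eq_zero fun p hp => ?_
    obtain ⟨β', rfl⟩ := hβ
    rw [HasAntidiagonal.mem_antidiagonal] at hp
    rw [hf p.2 ⟨p.1 + β', by rw [← hp]; abel⟩, mul_zero]

theorem mem_summandIdeal {δ : H} {f : FormalQSum H} :
    f ∈ summandIdeal δ ↔ ∀ β, (∃ β', β + β' = δ) → f.coeff β = 0 := Iff.rfl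

theorem eq_of_forall_mk_summandIdeal_eq {f g : FormalQSum H}
    (h : ∀ δ, Ideal.Quotient.mk (summandIdeal δ) f = Ideal.Quotient.mk (summandIdeal δ) g) :
    f = g := by
  ext δ
  have := mem_summandIdeal.1 (Ideal.Quotient.eq.1 (h δ)) δ ⟨0, add_zero δ⟩
  rw [coeff_sub] at this
  linarith

theorem coeff_eq_of_mk_eq_one {δ : H} {f : FormalQSum H}
    (h : Ideal.Quotient.mk (summandIdeal δ) f = 1) {β : H} (hβ : ∃ β', β + β' = δ) :
    f.coeff β = (1 : FormalQSum H).coeff β := by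
  rw [← map_one (Ideal.Quotient.mk (summandIdeal δ))] at h
  have := mem_summandIdeal.1 (Ideal.Quotient.eq.1 h) β hβ
  rw [coeff_sub] at this
  linarith

theorem mk_eq_one_of_coeff_eq {δ : H} {f : FormalQSum H}
    (h : ∀ β, (∃ β', β + β' = δ) → f.coeff β = (1 : FormalQSum H).coeff β) :
    Ideal.Quotient.mk (summandIdeal δ) f = 1 := by
  rw [← map_one (Ideal.Quotient.mk (summandIdeal δ)), Ideal.Quotient.eq, mem_summandIdeal]
  intro β hβ
  rw [coeff_sub, h β hβ, sub_self]

theorem finite_setOf_summand (δ : H) : {β : H | ∃ β', β + β' = δ}.Finite := by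
  refine ((antidiagonal δ).finite_toSet.image Prod.fst).subset ?_
  rintro β ⟨β', h⟩
  exact ⟨(β, β'), by simpa using h, rfl⟩

variable {I : Type*}

theorem coeff_one_of_ne {β : H} (hβ : β ≠ 0) : (1 : FormalQSum H).coeff β = 0 := by
  rw [one_eq_qpow, coeff_qpow, if_neg hβ]

theorem coeff_one_zero : (1 : FormalQSum H).coeff 0 = 1 := by
  rw [one_eq_qpow, coeff_qpow, if_pos rfl]

/-- Only the finitely many summands of δ are visible in the quotient, and each of them excludes
finitely many members of the family. -/
theorem IsMultipliable.finite_mulSupport_mk {f : I → FormalQSum H} (hf : IsMultipliable f) (δ : H) :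
    (Function.mulSupport fun i => Ideal.Quotient.mk (summandIdeal δ) (f i)).Finite := by
  refine (hf.1.union (((finite_setOf_summand δ).subset
    (Set.inter_subset_left (t := {β | β ≠ 0}))).biUnion fun β hβ => hf.2 β hβ.2)).subset
    fun i hi => ?_
  by_contra hcon
  simp only [Set.mem_union, Set.mem_ofPred_eq, not_or, not_not, Set.mem_iUnion, not_exists] at hcon
  refine hi (mk_eq_one_of_coeff_eq fun β hβ => ?_)
  by_cases h0 : β = 0
  · rw [h0, hcon.1, coeff_one_zero]
  · rw [coeff_one_of_ne h0, hcon.2 β ⟨hβ, h0⟩]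

open Classical in
theorem coeff_prod (f : I → FormalQSum H) (s : Finset I) (δ : H) :
    (∏ i ∈ s, f i).coeff δ = ∑ v ∈ finsuppAntidiag s δ, ∏ i ∈ s, (f i).coeff (v i) := by
  induction s using Finset.induction_on generalizing δ with
  | empty =>
    rw [prod_empty]
    by_cases h : δ = 0
    · subst h; simp [coeff_one_zero]
    · simp [finsuppAntidiag_empty_of_ne_zero h, coeff_one_of_ne h]
  | insert a s ha ih =>
    rw [prod_insert ha, coeff_mul]
    simp only [ih, mul_sum]
    rw [sum_sigma']
    refine sum_nbij' (fun x => Finsupp.update x.2 a x.1.1)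
      (fun v => ⟨(v a, ∑ i ∈ s, v i), v.erase a⟩) ?_ ?_ ?_ ?_ ?_
    · rintro ⟨p, v⟩ h
      rw [mem_sigma] at h
      exact (mem_finsuppAntidiag_insert ha δ).2 ⟨p, h.1, v, rfl, h.2⟩
    · intro v hv
      rw [mem_finsuppAntidiag, sum_insert ha] at hv
      rw [mem_sigma, HasAntidiagonal.mem_antidiagonal, mem_finsuppAntidiag]
      refine ⟨hv.1, sum_congr rfl fun i hi => ?_, ?_⟩
      · rw [Finsupp.erase_ne (ne_of_mem_of_not_mem hi ha)]
      · rw [Finsupp.support_erase, ← subset_insert_iff]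
        exact hv.2
    · rintro ⟨⟨p, r⟩, v⟩ h
      rw [mem_sigma, mem_finsuppAntidiag] at h
      have hva : v a = 0 := Finsupp.notMem_support_iff.1 fun h' => ha (h.2.2 h')
      have h1 : ∑ i ∈ s, (Finsupp.update v a p) i = r := by
        refine Eq.trans (sum_congr rfl fun i hi => ?_) h.2.1
        rw [Finsupp.coe_update, Function.update_of_ne (ne_of_mem_of_not_mem hi ha)]
      have h2 : (Finsupp.update v a p).erase a = v := by
        ext i
        by_cases hia : i = a
        · subst hia
          rw [Finsupp.erase_same, hva]
        · rw [Finsupp.erase_ne hia, Finsupp.coe_update, Function.update_of_ne hia]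
      have h3 : (Finsupp.update v a p) a = p := by
        rw [Finsupp.coe_update, Function.update_self]
      simp only [h1, h2, h3]
    · intro v _
      simp only [Finsupp.update_erase_eq_update, Finsupp.update_self]
    · rintro ⟨p, v⟩ _
      rw [prod_insert ha, Finsupp.coe_update, Function.update_self]
      congr 1
      refine prod_congr rfl fun i hi => ?_
      rw [Function.update_of_ne (ne_of_mem_of_not_mem hi ha)]

/-- Modulo the ideal of a fixed exponent, an infinite product is a finite product. -/
theorem mk_qprod {f : I → FormalQSum H} {δ : H}
    (hf : (Function.mulSupport fun i => Ideal.Quotient.mk (summandIdeal δ) (f i)).Finite) :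
    Ideal.Quotient.mk (summandIdeal δ) (qprod f) =
      ∏ᶠ i, Ideal.Quotient.mk (summandIdeal δ) (f i) := by
  classical
  rw [finprod_eq_prod _ hf, ← map_prod, Ideal.Quotient.eq, mem_summandIdeal]
  intro β hβ
  -- Summands of β are summands of δ, so the factors outside the finite set look like 1 at all
  -- exponents that can occur.
  have hout : ∀ i ∉ hf.toFinset, ∀ α, (∃ α', α + α' = β) →
      (f i).coeff α = (1 : FormalQSum H).coeff α := by
    rintro i hi α ⟨α', rfl⟩
    obtain ⟨β', rfl⟩ := hβ
    refine coeff_eq_of_mk_eq_one (δ := α + α' + β') ?_ ⟨α' + β', by abel⟩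
    simpa using hi
  have h0 : ∀ i ∉ hf.toFinset, (f i).coeff 0 = 1 := fun i hi => by
    rw [hout i hi 0 ⟨β, zero_add β⟩, coeff_one_zero]
  rw [coeff_sub, sub_eq_zero, coeff_prod]
  -- Without this finiteness `∏ᶠ` would take its default value 1, and a zero factor would not
  -- annihilate it.
  have hfin : ∀ v : I →₀ H, (Function.mulSupport fun i => (f i).coeff (v i)).Finite := fun v => by
    refine (hf.toFinset ∪ v.support).finite_toSet.subset fun i hi => ?_
    by_contra hcon
    simp only [coe_union, Set.mem_union, mem_coe, not_or, Finsupp.mem_support_iff,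
      not_not] at hcon
    exact hi (by simp only; rw [hcon.2, h0 i hcon.1])
  change ∑ᶠ (v : I →₀ H) (_ : (v.sum fun _ x => x) = β), ∏ᶠ i, (f i).coeff (v i) = _
  rw [finsum_eq_sum_of_support_subset (s := finsuppAntidiag hf.toFinset β)]
  · refine sum_congr rfl fun v hv => ?_
    rw [mem_finsuppAntidiag'] at hv
    rw [finsum_eq_if, if_pos hv.1]
    refine finprod_eq_prod_of_mulSupport_subset _ fun i hi => ?_
    by_contra hcon
    refine hi ?_
    have : v i = 0 := by
      by_contra h
      exact hcon (hv.2 (Finsupp.mem_support_iff.2 h))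
    simp only
    rw [this, h0 i hcon]
  · intro v hv
    rw [Function.mem_support, finsum_eq_if] at hv
    have hsum : (v.sum fun _ x => x) = β := by
      by_contra h
      exact hv (if_neg h)
    rw [if_pos hsum] at hv
    rw [mem_coe, mem_finsuppAntidiag']
    refine ⟨hsum, fun i hi => ?_⟩
    by_contra hcon
    -- A family with a nonzero member outside the finite set has a zero factor there, because that
    -- member is a summand of β.
    refine hv (finprod_eq_zero _ i ?_ (hfin v))
    have hi0 : v i ≠ 0 := Finsupp.mem_support_iff.1 hi
    rw [hout i hcon, coeff_one_of_ne hi0]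
    exact ⟨∑ j ∈ v.support.erase i, v j, by rw [add_sum_erase _ _ hi]; exact hsum⟩

end Ideal

/-! ### Power series in `q^γ` -/

section Radial

variable {K : Type*} [Field K] [NumberField K] [IsTotallyReal K]

open Classical in
/-- The formal `q`-sum `∑ a_n q^{nγ}` with the coefficients of a power series. -/
noncomputable def radialFun (γ : OPlus K) (f : ℝ⟦X⟧) : FormalQSum (OPlusZero K) := fun β =>
  if h : ∃ n : ℕ, n • γ.1 = β then PowerSeries.coeff h.choose f else 0

theorem coeff_radialFun_nsmul (γ : OPlus K) (f : ℝ⟦X⟧) (n : ℕ) :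
    (radialFun γ f).coeff (n • γ.1) = PowerSeries.coeff n f := by
  have h : ∃ m : ℕ, m • γ.1 = n • γ.1 := ⟨n, rfl⟩
  refine (dif_pos h).trans ?_
  rw [OPlusZero.nsmul_right_cancel γ.ne_zero h.choose_spec]

theorem coeff_radialFun_of_forall_ne {γ : OPlus K} (f : ℝ⟦X⟧) {β : OPlusZero K}
    (h : ∀ n : ℕ, n • γ.1 ≠ β) : (radialFun γ f).coeff β = 0 :=
  dif_neg fun ⟨n, hn⟩ => h n hn

theorem radialFun_X_pow (γ : OPlus K) (n : ℕ) : radialFun γ (X ^ n) = qpow (n • γ.1) := by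
  ext β
  rw [coeff_qpow]
  by_cases h : ∃ m : ℕ, m • γ.1 = β
  · obtain ⟨m, rfl⟩ := h
    rw [coeff_radialFun_nsmul, coeff_X_pow]
    congr 1
    exact propext ⟨fun h => by rw [h], OPlusZero.nsmul_right_cancel γ.ne_zero⟩
  · push Not at h
    rw [coeff_radialFun_of_forall_ne _ h, if_neg (h n).symm]

/-- Substitution of `q^γ` into a power series. -/
noncomputable def radial (γ : OPlus K) : ℝ⟦X⟧ →+* FormalQSum (OPlusZero K) where
  toFun := radialFun γ
  map_one' := by
    rw [← pow_zero X, radialFun_X_pow, zero_nsmul, one_eq_qpow]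
  map_zero' := by
    ext β
    by_cases h : ∃ m : ℕ, m • γ.1 = β
    · obtain ⟨m, rfl⟩ := h
      rw [coeff_radialFun_nsmul, map_zero, coeff_zero]
    · push Not at h
      rw [coeff_radialFun_of_forall_ne _ h, coeff_zero]
  map_add' f g := by
    ext β
    rw [coeff_add]
    by_cases h : ∃ m : ℕ, m • γ.1 = β
    · obtain ⟨m, rfl⟩ := h
      simp only [coeff_radialFun_nsmul, map_add]
    · push Not at h
      simp only [coeff_radialFun_of_forall_ne _ h, add_zero]
  map_mul' f g := by
    ext β
    rw [coeff_mul]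
    by_cases h : ∃ m : ℕ, m • γ.1 = β
    · obtain ⟨m, rfl⟩ := h
      rw [coeff_radialFun_nsmul, PowerSeries.coeff_mul]
      -- Decompositions of m embed into those of mγ; any other decomposition has a part that is not
      -- a multiple of γ and contributes 0.
      refine sum_of_injOn (fun p => (p.1 • γ.1, p.2 • γ.1)) ?_ ?_ ?_ ?_
      · rintro ⟨a, b⟩ - ⟨c, d⟩ - h
        simp only [Prod.mk.injEq] at h ⊢
        exact ⟨OPlusZero.nsmul_right_cancel γ.ne_zero h.1,
          OPlusZero.nsmul_right_cancel γ.ne_zero h.2⟩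
      · rintro ⟨a, b⟩ hab
        simp only [mem_coe, HasAntidiagonal.mem_antidiagonal] at hab ⊢
        rw [← hab, add_nsmul]
      · rintro ⟨α, β⟩ hp hnot
        rw [HasAntidiagonal.mem_antidiagonal] at hp
        by_cases h1 : ∃ a : ℕ, a • γ.1 = α
        · by_cases h2 : ∃ b : ℕ, b • γ.1 = β
          · obtain ⟨a, rfl⟩ := h1
            obtain ⟨b, rfl⟩ := h2
            refine absurd ⟨(a, b), ?_, rfl⟩ hnot
            rw [mem_coe, HasAntidiagonal.mem_antidiagonal]
            refine OPlusZero.nsmul_right_cancel γ.ne_zero ?_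
            rw [add_nsmul]
            exact hp
          · push Not at h2
            rw [coeff_radialFun_of_forall_ne _ h2, mul_zero]
        · push Not at h1
          rw [coeff_radialFun_of_forall_ne _ h1, zero_mul]
      · rintro ⟨a, b⟩ -
        simp only [coeff_radialFun_nsmul]
    · push Not at h
      rw [coeff_radialFun_of_forall_ne _ h]
      refine (sum_eq_zero fun p hp => ?_).symm
      rw [HasAntidiagonal.mem_antidiagonal] at hp
      by_cases h1 : ∃ a : ℕ, a • γ.1 = p.1
      · by_cases h2 : ∃ b : ℕ, b • γ.1 = p.2
        · obtain ⟨a, ha⟩ := h1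
          obtain ⟨b, hb⟩ := h2
          exact absurd (by rw [add_nsmul, ha, hb, hp]) (h (a + b))
        · push Not at h2
          rw [coeff_radialFun_of_forall_ne _ h2, mul_zero]
      · push Not at h1
        rw [coeff_radialFun_of_forall_ne _ h1, zero_mul]

theorem coeff_radial_nsmul (γ : OPlus K) (f : ℝ⟦X⟧) (n : ℕ) :
    (radial γ f).coeff (n • γ.1) = PowerSeries.coeff n f := coeff_radialFun_nsmul γ f n

theorem coeff_radial_of_forall_ne {γ : OPlus K} (f : ℝ⟦X⟧) {β : OPlusZero K}
    (h : ∀ n : ℕ, n • γ.1 ≠ β) : (radial γ f).coeff β = 0 := coeff_radialFun_of_forall_ne f h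

theorem radial_X_pow (γ : OPlus K) (n : ℕ) : radial γ (X ^ n) = qpow (n • γ.1) :=
  radialFun_X_pow γ n

theorem inverse_radial (γ : OPlus K) {f g : ℝ⟦X⟧} (h : f * g = 1) :
    Ring.inverse (radial γ f) = radial γ g := by
  have hu : radial γ f * radial γ g = 1 := by rw [← map_mul, h, map_one]
  calc Ring.inverse (radial γ f) = Ring.inverse (radial γ f) * (radial γ f * radial γ g) := by
        rw [hu, mul_one]
    _ = radial γ g := by
        rw [← mul_assoc, Ring.inverse_mul_cancel _ (IsUnit.of_mul_eq_one _ hu), one_mul]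

theorem inverse_one_sub_qpow_eq_radial (γ : OPlus K) {n : ℕ} (hn : n ≠ 0) :
    Ring.inverse (1 - qpow (n • γ.1)) = radial γ (1 - X ^ n)⁻¹ := by
  rw [← inverse_radial γ (PowerSeries.mul_inv_cancel (1 - X ^ n : ℝ⟦X⟧) (by simp [hn])),
    map_sub, map_one, radial_X_pow]

theorem qPoch_eq_radial (γ : OPlus K) (n : ℕ) :
    qPoch γ.1 n = radial γ (qPochhammer X n) := by
  induction n with
  | zero => simp [qPoch, qPochhammer_zero]
  | succ n ih =>
    rw [qPochhammer_succ, map_mul, ← ih, qPoch, qPoch, prod_Icc_succ_top (by omega), map_sub,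
      map_one, radial_X_pow]

/-- Continuity of the substitution: only finitely many multiples nγ are summands of δ, so high
powers of X die in the quotient. -/
theorem radial_mk_eq_of_X_pow_dvd (γ : OPlus K) (δ : OPlusZero K) :
    ∃ N : ℕ, ∀ n, N ≤ n → ∀ f g : ℝ⟦X⟧, X ^ n ∣ f - g →
      Ideal.Quotient.mk (summandIdeal δ) (radial γ f) =
        Ideal.Quotient.mk (summandIdeal δ) (radial γ g) := by
  have hfin : {n : ℕ | ∃ β', n • γ.1 + β' = δ}.Finite :=
    (finite_setOf_summand δ).preimage (f := fun n : ℕ => n • γ.1) fun a _ b _ hab =>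
      OPlusZero.nsmul_right_cancel γ.ne_zero hab
  obtain ⟨N, hN⟩ := hfin.bddAbove
  refine ⟨N + 1, fun n hn f g hfg => ?_⟩
  rw [Ideal.Quotient.eq, ← map_sub, mem_summandIdeal]
  intro β hβ
  by_cases h : ∃ m : ℕ, m • γ.1 = β
  · obtain ⟨m, rfl⟩ := h
    have : m ≤ N := hN hβ
    rw [coeff_radial_nsmul]
    exact X_pow_dvd_iff.1 hfg m (by omega)
  · push Not at h
    exact coeff_radial_of_forall_ne _ h

/-- If q^δ with δ ≠ 0 occurs in the j-th member, then δ is a positive multiple of g j, so g j is one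
of the finitely many summands of δ. -/
theorem isMultipliable_radial {I : Type*} {g : I → OPlus K} (hg : Function.Injective g)
    (F : I → ℝ⟦X⟧) (hF : ∀ j, constantCoeff (F j) = 1) :
    IsMultipliable fun j => radial (g j) (F j) := by
  constructor
  · convert Set.finite_empty
    ext j
    have := coeff_radial_nsmul (g j) (F j) 0
    rw [zero_nsmul] at this
    simp [this, hF]
  · intro δ hδ
    refine Set.Finite.of_finite_image ((finite_setOf_summand δ).subset ?_)
      (f := fun j => (g j).1) fun a _ b _ hab => hg (Subtype.ext hab)
    rintro _ ⟨j, hj, rfl⟩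
    by_contra hcon
    refine hj (coeff_radial_of_forall_ne _ fun n hn => ?_)
    rcases n with _ | n
    · exact hδ (by rw [← hn, zero_nsmul])
    · exact hcon ⟨n • (g j).1, by rw [← hn, succ_nsmul, add_comm]⟩

end Radial

end FormalQSum

/-! ### The Gordon identities for totally positive integers -/

section Gordon

variable {K : Type*} [Field K] [NumberField K] [IsTotallyReal K]

open FormalQSum

theorem GordonAdmissible.ne_zero {k i n : ℕ} (h : GordonAdmissible k i n) : n ≠ 0 := by
  rintro rfl
  exact h.1 rfl

theorem gordonTerm_eq_radial (l i : ℕ) (γ : OPlus K) (n : Fin l → ℕ) :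
    gordonTerm (k := l + 1) i γ n = radial γ (gordonSeriesTerm l i 0 n) := by
  have h : ∏ j : Fin l, qPoch γ.1 (n j) = radial γ (∏ j : Fin l, qPochhammer X (n j)) := by
    rw [map_prod]
    exact prod_congr rfl fun j _ => qPoch_eq_radial γ (n j)
  have hinv : (∏ j : Fin l, qPochhammer (X : ℝ⟦X⟧) (n j)) *
      ∏ j : Fin l, (qPochhammer X (n j))⁻¹ = 1 := by
    rw [← prod_mul_distrib]
    exact prod_eq_one fun j _ => qPochhammer_mul_inv (n j)
  have h1 : gordonTerm (k := l + 1) i γ n = qpow (gordonExponent (k := l + 1) i n • γ.1) *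
    Ring.inverse (∏ j : Fin l, qPoch γ.1 (n j)) := rfl
  rw [h1, h, inverse_radial γ hinv, gordonSeriesTerm, map_mul, radial_X_pow, zero_mul, add_zero]

theorem isSummable_gordonTerm (l i : ℕ) (γ : OPlus K) :
    IsSummable fun n : Fin l → ℕ => gordonTerm (k := l + 1) i γ n := by
  intro β
  simp only [gordonTerm_eq_radial]
  by_cases h : ∃ m : ℕ, m • γ.1 = β
  · obtain ⟨m, rfl⟩ := h
    simp only [coeff_radial_nsmul]
    exact ((WithPiTopology.summable_iff_summable_coeff _).1 (summable_gordonSeriesTerm l i 0) m).abs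
  · push Not at h
    simp only [coeff_radial_of_forall_ne _ h, abs_zero]
    exact summable_zero

theorem gordonSum_eq_radial {l i : ℕ} (hi : i ≠ 0) (γ : OPlus K) :
    gordonSum (l + 1) i γ = radial γ (andrewsSeries l i 0) := by
  ext β
  change ∑' n : Fin l → ℕ, (gordonTerm (k := l + 1) i γ n).coeff β = _
  simp only [gordonTerm_eq_radial]
  by_cases h : ∃ m : ℕ, m • γ.1 = β
  · obtain ⟨m, rfl⟩ := h
    simp only [coeff_radial_nsmul]
    exact ((WithPiTopology.hasSum_iff_hasSum_coeff _).1 (hasSum_gordonSeriesTerm hi 0) m).tsum_eq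
  · push Not at h
    simp only [coeff_radial_of_forall_ne _ h, tsum_zero]

theorem constantCoeff_andrewsSeries (l m : ℕ) {i : ℕ} (hi : i ≠ 0) :
    constantCoeff (andrewsSeries l i m) = 1 := by
  have := X_pow_dvd_iff.1 (X_pow_dvd_andrewsSeries_sub_one l m hi) 0 (Nat.succ_pos m)
  rw [map_sub, coeff_zero_eq_constantCoeff, map_one] at this
  linarith

theorem isMultipliable_gordonSum {l i : ℕ} (hi : i ≠ 0) :
    IsMultipliable fun γ : primitiveSet K => gordonSum (l + 1) i γ.1 := by
  simp only [gordonSum_eq_radial hi]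
  exact isMultipliable_radial Subtype.val_injective _ fun _ => constantCoeff_andrewsSeries l 0 hi

/-- The totally positive integer `n γ` for `n ≠ 0`. -/
def OPlus.mulNat (γ : OPlus K) (n : ℕ) (hn : n ≠ 0) : OPlus K :=
  ⟨n • γ.1, OPlusZero.isTotallyPositive fun h =>
    hn (OPlusZero.nsmul_right_cancel γ.ne_zero (h.trans (zero_nsmul _).symm))⟩

/-- Each factor is the series 1/(1 - X) along its own exponent, so one argument serves both the
multiples nγ of a fixed γ and the family of all δ of admissible scale. -/
theorem isMultipliable_inverse_one_sub_qpow {I : Type*} {g : I → OPlus K}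
    (hg : Function.Injective g) : IsMultipliable fun j => Ring.inverse (1 - qpow (g j).1) := by
  have h : ∀ j, Ring.inverse (1 - qpow (g j).1) = radial (g j) (1 - X ^ 1)⁻¹ := fun j => by
    rw [← inverse_one_sub_qpow_eq_radial (g j) one_ne_zero, one_nsmul]
  simp only [h]
  exact isMultipliable_radial hg _ fun _ => by simp

theorem isMultipliable_inverse_one_sub_qpow_nsmul (k i : ℕ) (γ : OPlus K) :
    IsMultipliable fun n : {n : ℕ // GordonAdmissible k i n} =>
      Ring.inverse (1 - qpow (n.1 • γ.1)) :=
  isMultipliable_inverse_one_sub_qpow (g := fun n : {n : ℕ // GordonAdmissible k i n} =>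
    γ.mulNat n.1 n.2.ne_zero) fun _ _ hab =>
      Subtype.ext (OPlusZero.nsmul_right_cancel γ.ne_zero (congrArg Subtype.val hab))

/-- The Gordon identity in powers of `q^γ`. -/
theorem qprod_inverse_eq_gordonSum {l i : ℕ} (hi : 1 ≤ i) (hil : i ≤ l + 1) (γ : OPlus K) :
    qprod (fun n : {n : ℕ // GordonAdmissible (l + 1) i n} =>
      Ring.inverse (1 - qpow (n.1 • γ.1))) = gordonSum (l + 1) i γ := by
  classical
  refine eq_of_forall_mk_summandIdeal_eq fun δ => ?_
  rw [mk_qprod ((isMultipliable_inverse_one_sub_qpow_nsmul _ i γ).finite_mulSupport_mk δ),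
    gordonSum_eq_radial (by omega)]
  obtain ⟨N, hN⟩ := radial_mk_eq_of_X_pow_dvd γ δ
  set φ : ℝ⟦X⟧ →+* _ := (Ideal.Quotient.mk (summandIdeal δ)).comp (radial γ) with hφ
  have hinv : ∀ n : ℕ, n ≠ 0 → (1 - X ^ n : ℝ⟦X⟧) * (1 - X ^ n)⁻¹ = 1 := fun n hn =>
    PowerSeries.mul_inv_cancel _ (by simp [hn])
  have h1 : ∀ n : {n : ℕ // GordonAdmissible (l + 1) i n},
      Ideal.Quotient.mk (summandIdeal δ) (Ring.inverse (1 - qpow (n.1 • γ.1))) =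
        φ (1 - X ^ n.1)⁻¹ := fun n => by
    rw [inverse_one_sub_qpow_eq_radial γ n.2.ne_zero]; rfl
  set M := (2 * (l + 1) + 1) * N with hM
  have hNM : N ≤ M := Nat.le_mul_of_pos_left _ (by omega)
  set S : Finset ℕ := (range M).filter fun n => GordonAdmissible (l + 1) i (n + 1) with hS
  have h2 : ∏ᶠ n : {n : ℕ // GordonAdmissible (l + 1) i n}, φ (1 - X ^ n.1)⁻¹ =
      φ (∏ n ∈ S, (1 - X ^ (n + 1))⁻¹) := by
    -- Here (1 - X^n)⁻¹ - 1 = X^n (1 - X^n)⁻¹ with n ≥ N, so the factor is invisible in the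
    -- quotient.
    have hbig : ∀ n, M < n → φ (1 - X ^ n)⁻¹ = 1 := fun n hn => by
      rw [← map_one φ]
      refine hN n (by omega) _ _ ⟨(1 - X ^ n)⁻¹, ?_⟩
      linear_combination hinv n (by omega)
    rw [finprod_subtype_eq_finprod_cond (fun n => GordonAdmissible (l + 1) i n)
      (f := fun n => φ (1 - X ^ n)⁻¹), map_prod]
    refine Eq.trans ?_ (prod_map S (addRightEmbedding 1) fun n => φ (1 - X ^ n)⁻¹)
    refine finprod_mem_eq_prod_of_inter_mulSupport_eq _ (s := {n | GordonAdmissible (l + 1) i n}) ?_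
    ext n
    simp only [Set.mem_inter_iff, coe_map, Set.mem_image, mem_coe, hS, mem_filter, mem_range,
      addRightEmbedding_apply]
    refine and_congr_left fun hn => ⟨fun h => ⟨n - 1, ?_⟩, ?_⟩
    · have hn0 := GordonAdmissible.ne_zero h
      have e : n - 1 + 1 = n := by omega
      refine ⟨⟨?_, e ▸ h⟩, e⟩
      by_contra hlt
      exact hn (hbig n (by omega))
    · rintro ⟨m, ⟨-, hm⟩, rfl⟩
      exact hm
  have h3 : φ (andrewsSeries l i 0 * ∏ n ∈ S, (1 - X ^ (n + 1))) = φ 1 :=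
    hN (N + 1) (by omega) _ _ (X_pow_dvd_andrewsSeries_mul_prod_sub_one hi hil N)
  have h4 : (∏ n ∈ S, (1 - X ^ (n + 1) : ℝ⟦X⟧)) * ∏ n ∈ S, (1 - X ^ (n + 1))⁻¹ = 1 := by
    rw [← prod_mul_distrib]
    exact prod_eq_one fun n _ => hinv (n + 1) (by omega)
  rw [finprod_congr h1, h2]
  calc φ (∏ n ∈ S, (1 - X ^ (n + 1))⁻¹)
      = φ 1 * φ (∏ n ∈ S, (1 - X ^ (n + 1))⁻¹) := by rw [map_one, one_mul]
    _ = φ (andrewsSeries l i 0 *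
          ((∏ n ∈ S, (1 - X ^ (n + 1))) * ∏ n ∈ S, (1 - X ^ (n + 1))⁻¹)) := by
        rw [← h3, ← map_mul, mul_assoc]
    _ = φ (andrewsSeries l i 0) := by rw [h4, mul_one]

theorem radial_unique {δ γ : OPlus K} {n : ℕ} (hγ : γ ∈ primitiveSet K) (h : δ.1 = n • γ.1) :
    scale δ = n ∧ primitiveFactor δ = γ := by
  have := δ.existsUnique_radial.choose_spec.2 (n, γ) ⟨hγ, h⟩
  exact ⟨(congrArg Prod.fst this).symm, (congrArg Prod.snd this).symm⟩

/-- Grouping the totally positive integers by their primitive factors. -/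
theorem qprod_qprod_eq_qprod_scale {k i : ℕ}
    (hmul : IsMultipliable fun γ : primitiveSet K => qprod
      fun n : {n : ℕ // GordonAdmissible k i n} => Ring.inverse (1 - qpow (n.1 • γ.1.1))) :
    qprod (fun γ : primitiveSet K => qprod
        (fun n : {n : ℕ // GordonAdmissible k i n} => Ring.inverse (1 - qpow (n.1 • γ.1.1)))) =
      qprod (fun δ : {δ : OPlus K // GordonAdmissible k i (scale δ)} =>
        Ring.inverse (1 - qpow δ.1.1)) := by
  refine eq_of_forall_mk_summandIdeal_eq fun δ => ?_
  have hfin := (isMultipliable_inverse_one_sub_qpow (Subtype.val_injective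
    (p := fun δ : OPlus K => GordonAdmissible k i (scale δ)))).finite_mulSupport_mk δ
  rw [mk_qprod (hmul.finite_mulSupport_mk δ), mk_qprod hfin]
  -- The map (γ, n) ↦ nγ; uniqueness of the radial decomposition gives scale n and injectivity,
  -- existence gives surjectivity.
  let e : primitiveSet K × {n : ℕ // GordonAdmissible k i n} →
      {δ : OPlus K // GordonAdmissible k i (scale δ)} := fun p =>
    ⟨p.1.1.mulNat p.2.1 p.2.2.ne_zero, by
      rw [(radial_unique p.1.2 (δ := p.1.1.mulNat p.2.1 p.2.2.ne_zero) rfl).1]; exact p.2.2⟩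
  have he : Function.Bijective e := by
    constructor
    · rintro ⟨γ, n⟩ ⟨γ', n'⟩ h
      have h1 := radial_unique γ.2 (δ := γ.1.mulNat n.1 n.2.ne_zero) rfl
      have h2 := radial_unique γ'.2 (δ := γ'.1.mulNat n'.1 n'.2.ne_zero) rfl
      have h3 : γ.1.mulNat n.1 n.2.ne_zero = γ'.1.mulNat n'.1 n'.2.ne_zero :=
        congrArg Subtype.val h
      rw [h3] at h1
      exact Prod.ext (Subtype.ext (h1.2.symm.trans h2.2)) (Subtype.ext (h1.1.symm.trans h2.1))
    · intro δ
      exact ⟨⟨⟨primitiveFactor δ.1, primitiveFactor_mem δ.1⟩, ⟨scale δ.1, δ.2⟩⟩,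
        Subtype.ext (Subtype.ext (scale_nsmul_primitiveFactor δ.1).symm)⟩
  -- In the quotient only finitely many factors differ from 1, so the product over pairs may be
  -- taken iteratively.
  rw [← finprod_comp _ he, finprod_curry]
  · refine finprod_congr fun γ => ?_
    rw [mk_qprod ((isMultipliable_inverse_one_sub_qpow_nsmul k i γ.1).finite_mulSupport_mk δ)]
    rfl
  · exact hfin.preimage he.1.injOn

end Gordon

open FormalQSum in
theorem mainTheorem3 (K : Type*) [Field K] [NumberField K] [NumberField.IsTotallyReal K]
    (k i : ℕ) (hk : 2 ≤ k) (hi : 1 ≤ i) (hik : i ≤ k) :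
    -- all the infinite sums and products involved are defined
    (∀ γ ∈ primitiveSet K, IsSummable (fun n : Fin (k - 1) → ℕ => gordonTerm i γ n)) ∧
    IsMultipliable (fun γ : primitiveSet K => gordonSum k i γ.1) ∧
    (∀ γ ∈ primitiveSet K, IsMultipliable
      (fun n : {n : ℕ // GordonAdmissible k i n} => Ring.inverse (1 - qpow (n.1 • γ.1)))) ∧
    IsMultipliable (fun γ : primitiveSet K => qprod
      (fun n : {n : ℕ // GordonAdmissible k i n} => Ring.inverse (1 - qpow (n.1 • γ.1.1)))) ∧
    IsMultipliable (fun δ : {δ : OPlus K // GordonAdmissible k i (scale δ)} =>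
      Ring.inverse (1 - qpow δ.1.1)) ∧
    -- the two identities
    qprod (fun γ : primitiveSet K => gordonSum k i γ.1) =
      qprod (fun γ : primitiveSet K => qprod
        (fun n : {n : ℕ // GordonAdmissible k i n} => Ring.inverse (1 - qpow (n.1 • γ.1.1)))) ∧
    qprod (fun γ : primitiveSet K => qprod
        (fun n : {n : ℕ // GordonAdmissible k i n} => Ring.inverse (1 - qpow (n.1 • γ.1.1)))) =
      qprod (fun δ : {δ : OPlus K // GordonAdmissible k i (scale δ)} =>
        Ring.inverse (1 - qpow δ.1.1)) := by
  obtain ⟨l, rfl⟩ : ∃ l, k = l + 1 := ⟨k - 1, by omega⟩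
  have hmul := isMultipliable_gordonSum (K := K) (l := l) (i := i) (by omega)
  have heq : (fun γ : primitiveSet K => gordonSum (l + 1) i γ.1) = fun γ => qprod
      fun n : {n : ℕ // GordonAdmissible (l + 1) i n} => Ring.inverse (1 - qpow (n.1 • γ.1.1)) :=
    funext fun γ => (qprod_inverse_eq_gordonSum hi hik γ.1).symm
  refine ⟨fun γ _ => isSummable_gordonTerm l i γ, hmul,
    fun γ _ => isMultipliable_inverse_one_sub_qpow_nsmul _ i γ, heq ▸ hmul,
    isMultipliable_inverse_one_sub_qpow Subtype.val_injective, by rw [heq],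
    qprod_qprod_eq_qprod_scale (heq ▸ hmul)⟩
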